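/- Let $V$ be a Banach space and $T_0>0$. Let $\omega=(\omega_{s,t})_{0\le s\le t\le T_0}$ be a control: $\omega_{s,t}\ge 0$, $\omega_{s,s}=0$, $\omega_{r,s}+\omega_{s,t}\le\omega_{r,t}$ for $r\le s\le t$, and $\omega$ is continuous at the points of the diagonal. Let $\varpi:\mathbb R_+\to\mathbb R_+$ be continuous and non-decreasing with $2\varpi(x/2)\le\varkappa\,\varpi(x)$ for all $x>0$ and some $0<\varkappa<1$. Let $T\mapsto\delta_T\ge0$ be non-decreasing with $\delta_T\to0$ as $T\to0$, and let $\eta:\mathbb R_+\to\mathbb R_+$ be continuous and non-decreasing with $\eta(\omega_{s,t})\varpi(\omega_{s,t})\le\delta_T\varpi(\omega_{s,t})$ for $0\le s\le t\le T\le T_0$, $T>0$. Write $\|\cdot\|_\infty$ for the sup-norm of maps $V\to V$ and $\mathrm{Lip}(f)$ for the Lipschitz constant of $f$. A family $\phi=(\phi_{t,s})_{0\le s\le t\le T_0}$ of continuous maps $V\to V$ is a stable almost flow if, with constants $M,C\ge0$, for all $T\in(0,T_0]$, all $0\le r\le s\le t\le T$ and all $a,b,c,d\in V$: 1. $\phi_{t,t}=\mathrm{id}$,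 $\ \|\phi_{t,s}-\mathrm{id}\|_\infty\le\delta_T$, $\ |\phi_{t,s}(b)-\phi_{t,s}(a)|\le(1+\delta_T)|b-a|+\eta(\omega_{s,t})|b-a|$, $\ \|\phi_{t,s}\circ\phi_{s,r}-\phi_{t,r}\|_\infty\le M\varpi(\omega_{r,t})$; 2. $\mathrm{Lip}(\phi_{t,s}\circ\phi_{s,r}-\phi_{t,r})\le C\varpi(\omega_{r,t})$; 3. there are continuous non-decreasing functions $\widehat\phi_{t,s}:\mathbb R_+\to\mathbb R_+$ and constants $\widecheck\phi_{t,s}\ge 0$ (not depending on $T$) with $\widecheck\phi_{t,s}\le1+\delta_T$ and $$|\phi_{t,s}(a)-\phi_{t,s}(b)-\phi_{t,s}(c)+\phi_{t,s}(d)|\le\widehat\phi_{t,s}(|a-b|\vee|c-d|)\,(|a-c|\vee|b-d|)+\widecheck\phi_{t,s}|a-b-c+d|,$$ such that $\widehat\phi_{t,s}\le\widehat\phi_{v,u}$ whenever $[s,t]\subset[u,v]\subset[0,T_0]$ and, for every $\alpha\ge0$, there is a constant $\phi^\circledast(\alpha)\ge 0$ with $\widehat\phi_{t,s}(\alpha\varpi(\omega_{s,t}))\le\phi^\circledast(\alpha)\varpi(\omega_{s,t})$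 for all $s\le t$. For $T\in(0,T_0]$, the galaxy of $\phi$ on $[0,T]$ is the set of families $\chi=(\chi_{t,s})_{0\le s\le t\le T}$ of continuous maps with $\|\phi_{t,s}-\chi_{t,s}\|_\infty\le C'\varpi(\omega_{s,t})$ for some $C'\ge 0$ and all $0\le s\le t\le T$. A flow on $[0,T]$ is a family $(\psi_{t,s})_{s,t\in[0,T]}$ with $\psi_{t,t}=\mathrm{id}$, $\psi_{t,s}\circ\psi_{s,r}=\psi_{t,r}$ for $r\le s\le t$ and for $r\ge s\ge t$, and $\psi_{t,s}^{-1}=\psi_{s,t}$; it lies in the galaxy if $(\psi_{t,s})_{s\le t}$ does, and it is Lipschitz if $\sup_{s,t\in[0,T]}\mathrm{Lip}(\psi_{t,s})<\infty$. For a partition $\pi$ of $[0,T]$ (containing $0$ and $T$) and $s\le t$, let $t_i<\dots<t_j$ be the points of $\pi$ in $[s,t]$ and put $\phi^\pi_{t,s}=\phi_{t,t_j}\circ\phi_{t_j,t_{j-1}}\circ\dots\circ\phi_{t_{i+1},t_i}\circ\phi_{t_i,s}$ ($\phi^\pi_{t,s}=\phi_{t,s}$ if there are none). Corollary. Let $\phi$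 be a stable almost flow. Then there is $T_1\in(0,T_0]$ such that for every horizon $T\in(0,T_1]$ there is a Lipschitz flow $\psi$ on $[0,T]$ in the galaxy of $\phi$; it is the only flow on $[0,T]$ in this galaxy, hence the unique Lipschitz flow there. Moreover $\phi^\pi\to\psi$ in the sup-norm as the mesh of $\pi$ tends to $0$, that is, $\sup_{0\le s\le t\le T}\|\phi^\pi_{t,s}-\psi_{t,s}\|_\infty\to0$, and there is a constant $L\ge0$ such that $\mathrm{Lip}(\psi_{t,s}-\phi_{t,s})\le L\varpi(\omega_{s,t})$ for all $0\le s\le t\le T$. -/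

import Mathlib

open scoped NNReal Topology

namespace Sewing

/-- `ω` is a control on `{(s, t) : 0 ≤ s ≤ t ≤ T}`: it is non-negative, super-additive, zero on the
diagonal, and continuous at the diagonal. -/
structure IsControl (T : ℝ) (ω : ℝ → ℝ → ℝ≥0) : Prop where
  superadditive : ∀ r s t : ℝ, 0 ≤ r → r ≤ s → s ≤ t → t ≤ T → ω r s + ω s t ≤ ω r t
  diag : ∀ s : ℝ, 0 ≤ s → s ≤ T → ω s s = 0
  continuous_diag : ∀ s : ℝ, 0 ≤ s → s ≤ T →
    ContinuousWithinAt (fun p : ℝ × ℝ => ω p.1 p.2)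
      {p : ℝ × ℝ | 0 ≤ p.1 ∧ p.1 ≤ p.2 ∧ p.2 ≤ T} (s, s)

/-- A remainder: a continuous, increasing `ϖ : ℝ₊ → ℝ₊` with `2 ϖ(x / 2) ≤ κ ϖ(x)` for some
`0 < κ < 1`. -/
structure IsRemainder (ϖ : ℝ≥0 → ℝ≥0) : Prop where
  continuous : Continuous ϖ
  monotone : Monotone ϖ
  contraction : ∃ κ : ℝ≥0, 0 < κ ∧ κ < 1 ∧ ∀ x : ℝ≥0, 0 < x → 2 * ϖ (x / 2) ≤ κ * ϖ x

/-- The standing assumptions on the data `(ω, ϖ, δ, γ, η)` up to the time `T₀`. -/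
structure IsSetting (T₀ : ℝ) (ω : ℝ → ℝ → ℝ≥0) (ϖ : ℝ≥0 → ℝ≥0) (δ : ℝ → ℝ≥0) (γ : ℝ)
    (η : ℝ≥0 → ℝ≥0) : Prop where
  control : IsControl T₀ ω
  remainder : IsRemainder ϖ
  delta_mono : MonotoneOn δ (Set.Ici 0)
  delta_tendsto : Filter.Tendsto δ (𝓝[>] 0) (𝓝 0)
  gamma_pos : 0 < γ
  gamma_le_one : γ ≤ 1
  eta_continuous : Continuous η
  eta_mono : Monotone η
  eta_le : ∀ T : ℝ, 0 < T → T ≤ T₀ → ∀ s t : ℝ, 0 ≤ s → s ≤ t → t ≤ T →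
    η (ω s t) * ϖ (ω s t) ^ γ ≤ δ T * ϖ (ω s t)

variable {V : Type*} [NormedAddCommGroup V]

/-- Membership in `𝓕⁺(V)` over the horizon `T`. A family of maps of `V` is written `φ t s` for
`φ_{t,s}`; only its values at times in `[0, T]` matter. -/
def IsForwardFamily (T : ℝ) (φ : ℝ → ℝ → V → V) : Prop :=
  ∀ s t : ℝ, 0 ≤ s → s ≤ t → t ≤ T → Continuous (φ t s)

/-- Almost flow: the estimates hold on `[0, T]`, with the constant `δ T`, for every horizon
`T ∈ (0, T₀]`. -/
structure IsAlmostFlow (T₀ : ℝ) (ω : ℝ → ℝ → ℝ≥0) (ϖ : ℝ≥0 → ℝ≥0) (δ : ℝ → ℝ≥0) (γ : ℝ)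
    (η : ℝ≥0 → ℝ≥0) (φ : ℝ → ℝ → V → V) : Prop where
  family : IsForwardFamily T₀ φ
  diag : ∀ t : ℝ, 0 ≤ t → t ≤ T₀ → φ t t = id
  near_id : ∀ T : ℝ, 0 < T → T ≤ T₀ → ∀ s t : ℝ, 0 ≤ s → s ≤ t → t ≤ T →
    ∀ a : V, ‖φ t s a - a‖₊ ≤ δ T
  modulus : ∀ T : ℝ, 0 < T → T ≤ T₀ → ∀ s t : ℝ, 0 ≤ s → s ≤ t → t ≤ T →
    ∀ a b : V, ‖φ t s b - φ t s a‖₊ ≤ (1 + δ T) * ‖b - a‖₊ + η (ω s t) * ‖b - a‖₊ ^ γ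
  defect : ∃ M : ℝ≥0, ∀ r s t : ℝ, 0 ≤ r → r ≤ s → s ≤ t → t ≤ T₀ →
    ∀ a : V, ‖φ t s (φ s r a) - φ t r a‖₊ ≤ M * ϖ (ω r t)

/-- `f` satisfies the 4-points control with the function `fhat` and the constant `fcheck`. -/
structure FourPointsControl (f : V → V) (fhat : ℝ≥0 → ℝ≥0) (fcheck : ℝ≥0) : Prop where
  monotone : Monotone fhat
  continuous : Continuous fhat
  bound : ∀ a b c d : V, ‖f a - f b - f c + f d‖₊ ≤
    fhat (max ‖a - b‖₊ ‖c - d‖₊) * max ‖a - c‖₊ ‖b - d‖₊ + fcheck * ‖a - b - c + d‖₊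

/-- `φ` satisfies a `ϖ`-compatible 4-points control on `[0, T]` with the functions
`φhat t s` and the constants `φcheck t s`. -/
structure CompatibleFourPointsControl (T : ℝ) (ω : ℝ → ℝ → ℝ≥0) (ϖ : ℝ≥0 → ℝ≥0)
    (φ : ℝ → ℝ → V → V) (φhat : ℝ → ℝ → ℝ≥0 → ℝ≥0) (φcheck : ℝ → ℝ → ℝ≥0) : Prop where
  control : ∀ s t : ℝ, 0 ≤ s → s ≤ t → t ≤ T →
    FourPointsControl (φ t s) (φhat t s) (φcheck t s)
  mono : ∀ u s t v : ℝ, 0 ≤ u → u ≤ s → s ≤ t → t ≤ v → v ≤ T →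
    ∀ x : ℝ≥0, φhat t s x ≤ φhat v u x
  compatible : ∃ φstar : ℝ≥0 → ℝ≥0, ∀ α : ℝ≥0, ∀ s t : ℝ, 0 ≤ s → s ≤ t → t ≤ T →
    φhat t s (α * ϖ (ω s t)) ≤ φstar α * ϖ (ω s t)

/-- Stable almost flow. -/
structure IsStableAlmostFlow (T₀ : ℝ) (ω : ℝ → ℝ → ℝ≥0) (ϖ : ℝ≥0 → ℝ≥0) (δ : ℝ → ℝ≥0)
    (η : ℝ≥0 → ℝ≥0) (φ : ℝ → ℝ → V → V) : Prop where
  almostFlow : IsAlmostFlow T₀ ω ϖ δ 1 η φ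
  fourPoints : ∃ (φhat : ℝ → ℝ → ℝ≥0 → ℝ≥0) (φcheck : ℝ → ℝ → ℝ≥0),
    CompatibleFourPointsControl T₀ ω ϖ φ φhat φcheck ∧
    ∀ T : ℝ, 0 < T → T ≤ T₀ → ∀ s t : ℝ, 0 ≤ s → s ≤ t → t ≤ T → φcheck t s ≤ 1 + δ T
  lipschitz_defect : ∃ C : ℝ≥0, ∀ r s t : ℝ, 0 ≤ r → r ≤ s → s ≤ t → t ≤ T₀ →
    LipschitzWith (C * ϖ (ω r t)) (fun a : V => φ t s (φ s r a) - φ t r a)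

/-- `φ ∼ ψ` over the horizon `T`: the sup-distance of `φ_{t,s}` and `ψ_{t,s}` is at most
`C ϖ(ω_{s,t})`. -/
def GalaxyRel (T : ℝ) (ω : ℝ → ℝ → ℝ≥0) (ϖ : ℝ≥0 → ℝ≥0) (φ ψ : ℝ → ℝ → V → V) : Prop :=
  ∃ C : ℝ≥0, ∀ s t : ℝ, 0 ≤ s → s ≤ t → t ≤ T →
    ∀ a : V, ‖φ t s a - ψ t s a‖₊ ≤ C * ϖ (ω s t)

/-- The galaxy of `φ` in `𝓕⁺(V)` over the horizon `T`. -/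
def galaxy (T : ℝ) (ω : ℝ → ℝ → ℝ≥0) (ϖ : ℝ≥0 → ℝ≥0) (φ : ℝ → ℝ → V → V) :
    Set (ℝ → ℝ → V → V) :=
  {ψ | IsForwardFamily T ψ ∧ GalaxyRel T ω ϖ φ ψ}

/-- A flow on `[0, T]`: the composition rule holds for monotone triples of times in either
direction, and for `s ≤ t` the map `ψ t s` is invertible with inverse `ψ s t`. -/
structure IsFlow {W : Type*} (T : ℝ) (ψ : ℝ → ℝ → W → W) : Prop where
  diag : ∀ t : ℝ, 0 ≤ t → t ≤ T → ψ t t = id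
  comp : ∀ r s t : ℝ, (0 ≤ r ∧ r ≤ s ∧ s ≤ t ∧ t ≤ T) ∨ (0 ≤ t ∧ t ≤ s ∧ s ≤ r ∧ r ≤ T) →
    ψ t s ∘ ψ s r = ψ t r
  inverse : ∀ s t : ℝ, 0 ≤ s → s ≤ t → t ≤ T →
    Function.LeftInverse (ψ s t) (ψ t s) ∧ Function.RightInverse (ψ s t) (ψ t s)

/-- A Lipschitz flow on `[0, T]`: a flow whose maps are Lipschitz, uniformly in the times. -/
def IsLipschitzFlow (T : ℝ) (ψ : ℝ → ℝ → V → V) : Prop :=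
  IsFlow T ψ ∧ ∃ K : ℝ≥0, ∀ s t : ℝ, 0 ≤ s → s ≤ T → 0 ≤ t → t ≤ T → LipschitzWith K (ψ t s)

/-- A partition of `[0, T]`, as the finite set of its points. -/
def IsPartition (T : ℝ) (π : Finset ℝ) : Prop :=
  0 ∈ π ∧ T ∈ π ∧ ∀ u ∈ π, 0 ≤ u ∧ u ≤ T

/-- `u < v` are successive points of `π`. -/
def Successive (π : Finset ℝ) (u v : ℝ) : Prop :=
  u ∈ π ∧ v ∈ π ∧ u < v ∧ ∀ w ∈ π, w ≤ u ∨ v ≤ w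

/-- The mesh of `π`: the largest distance between successive points. -/
noncomputable def mesh (π : Finset ℝ) : ℝ :=
  sSup {d : ℝ | ∃ u v : ℝ, Successive π u v ∧ d = v - u}

/-- For a list `[r₀, …, r_m]` of times, the map
`φ_{t,r_m} ∘ φ_{r_m,r_{m-1}} ∘ ⋯ ∘ φ_{r₀,s}`; it is `φ_{t,s}` for the empty list. -/
def chain {W : Type*} (φ : ℝ → ℝ → W → W) (t : ℝ) : ℝ → List ℝ → W → W
  | s, [] => φ t s
  | s, r :: l => chain φ t r l ∘ φ r s

/-- The iterated product `φ^π_{t,s}`, along the points of `π` that lie in `[s, t]`. -/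
noncomputable def iteratedProduct {W : Type*} (φ : ℝ → ℝ → W → W) (π : Finset ℝ) (t s : ℝ) :
    W → W :=
  chain φ t s ((π.filter (fun u => s ≤ u ∧ u ≤ t)).sort (· ≤ ·))

/-- `φ^π` converges to `ψ` in the sup-norm as the mesh of the partition `π` of `[0, T]` goes to
`0`, uniformly in the times `s ≤ t`. -/
def IteratedProductsConverge (T : ℝ) (φ ψ : ℝ → ℝ → V → V) : Prop :=
  ∀ ε : ℝ, 0 < ε → ∃ ρ : ℝ, 0 < ρ ∧ ∀ π : Finset ℝ, IsPartition T π → mesh π < ρ →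
    ∀ s t : ℝ, 0 ≤ s → s ≤ t → t ≤ T → ∀ a : V, ‖iteratedProduct φ π t s a - ψ t s a‖ ≤ ε

end Sewing

/-!
The flow is the limit of the iterated products `φ^σ` along the directed set of all finite sets `σ`
of times.

*Short horizons.* Applied to parallelograms, the 4-points control says that the increments of
`φ_{t,s}` along a vector `k` vary by at most `φhat(ρ) ‖k‖` over distances up to `ρ`. Since
`φ_{t,s}` is also uniformly close to the identity, averaging over about `ρ / ‖k‖` increments shows
that `φ_{t,s} - id` is Lipschitz with a small constant
(`FourPointsControl.norm_sub_sub_le`). Compatibility with `ϖ` bounds `φhat(0)` by a multiple of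
`ϖ(ω_{0,T})`, so this constant is at most a prescribed `ε` on short horizons
(`IsStableAlmostFlow.exists_stableOn`). This serves twice: as the Lipschitz bound in the sewing
estimates, and for the invertibility of the flow in a space of infinite dimension.

*Sewing estimates.* The points of `σ` in `[s, t]` are split into two groups on which the control is
at most `ω_{s,t} / 2`, separated by one interval without points of `σ` (`exists_split`). By
induction on the number of points, with the contraction `2 ϖ(x / 2) ≤ κ ϖ(x)`, the product `φ^σ`
stays within `L₀ ϖ(ω_{s,t})` of `φ_{t,s}` in the sup-norm, and then within `L₁ ϖ(ω_{s,t})` in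
the Lipschitz seminorm. The second estimate uses the 4-points control at the scale given by the
first one.

*Limit, uniqueness, convergence.* Two families that split at the points of a fine set `σ`, one of
them uniformly Lipschitz, and that agree up to `D ϖ(ω)` on successive points are close: the errors
telescope to a multiple of `∑ ϖ(ω_{t_i,t_{i+1}})`, and `ϖ(x) = o(x)`
(`exists_forall_isFine_norm_sub_le`). This one comparison shows that the products form a Cauchy
net, that the flow is the only one in the galaxy, and that `φ^π` converges to it with the mesh.

*Inversion.* The limit `Ψ_{t,s}` differs from the identity by a map with Lipschitz constant at most
`1 / 2`, hence it is bijective and its inverse is `2`-Lipschitz.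
-/

namespace Sewing

/-! ### Remainders and controls -/

theorem IsRemainder.map_zero {ϖ : ℝ≥0 → ℝ≥0} (h : IsRemainder ϖ) : ϖ 0 = 0 := by
  obtain ⟨κ, -, hκ, hx⟩ := h.contraction
  have h1 : Filter.Tendsto (fun x : ℝ≥0 => 2 * ϖ (x / 2)) (𝓝[>] 0) (𝓝 (2 * ϖ (0 / 2))) :=
    ((continuous_const.mul (h.continuous.comp (continuous_id.div_const 2))).tendsto
      (0 : ℝ≥0)).mono_left nhdsWithin_le_nhds
  have h2 : Filter.Tendsto (fun x : ℝ≥0 => κ * ϖ x) (𝓝[>] 0) (𝓝 (κ * ϖ 0)) :=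
    ((continuous_const.mul h.continuous).tendsto (0 : ℝ≥0)).mono_left nhdsWithin_le_nhds
  have h3 : 2 * ϖ (0 / 2) ≤ κ * ϖ 0 :=
    le_of_tendsto_of_tendsto h1 h2 (eventually_nhdsWithin_of_forall fun x hx' => hx x hx')
  rw [zero_div] at h3
  have h4 : κ * ϖ 0 ≤ 1 * ϖ 0 := by gcongr
  have h5 : (2 : ℝ) * ϖ 0 ≤ 1 * ϖ 0 := by exact_mod_cast h3.trans h4
  have h6 : (0 : ℝ) ≤ ϖ 0 := (ϖ 0).coe_nonneg
  have h7 : (ϖ 0 : ℝ) = 0 := by linarith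
  exact_mod_cast h7

theorem IsRemainder.two_mul_le {ϖ : ℝ≥0 → ℝ≥0} (h : IsRemainder ϖ) {κ : ℝ≥0}
    (hκ : ∀ x : ℝ≥0, 0 < x → 2 * ϖ (x / 2) ≤ κ * ϖ x) {x y : ℝ≥0} (hxy : 2 * x ≤ y) :
    (2 : ℝ) * ϖ x ≤ κ * ϖ y := by
  have hx : x ≤ y / 2 := by
    rw [le_div_iff₀ (by norm_num), mul_comm]; exact hxy
  have h1 : 2 * ϖ x ≤ 2 * ϖ (y / 2) := by gcongr; exact h.monotone hx
  rcases eq_or_lt_of_le (zero_le : 0 ≤ y) with rfl | hy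
  · simp only [zero_div, h.map_zero] at h1 ⊢
    exact_mod_cast h1.trans (by simp)
  · exact_mod_cast h1.trans (hκ y hy)

/-- A remainder is `o(x)` at `0`: the ratio `ϖ x / x` shrinks by the factor `κ` whenever `x` is
halved. -/
theorem IsRemainder.eventually_le_mul {ϖ : ℝ≥0 → ℝ≥0} (h : IsRemainder ϖ) {ε : ℝ} (hε : 0 < ε) :
    ∃ ξ : ℝ≥0, 0 < ξ ∧ ∀ x : ℝ≥0, x ≤ ξ → (ϖ x : ℝ) ≤ ε * x := by
  obtain ⟨κ, hκ0, hκ1, hκ⟩ := h.contraction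
  have key : ∀ x : ℝ≥0, (2 : ℝ) * ϖ x ≤ κ * ϖ (2 * x) := fun x => h.two_mul_le hκ le_rfl
  have hκ1' : (κ : ℝ) < 1 := hκ1
  have base : ∀ m : ℕ, ∀ x : ℝ≥0, (1 / 2 : ℝ) ^ (m + 1) ≤ x → x ≤ 1 →
      (ϖ x : ℝ) ≤ 2 * ϖ 1 * x := by
    intro m
    induction m with
    | zero =>
      intro x hx hx1
      have h1 : (ϖ x : ℝ) ≤ ϖ 1 := by exact_mod_cast h.monotone hx1
      have h2 : (0 : ℝ) ≤ ϖ 1 := (ϖ 1).coe_nonneg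
      norm_num at hx
      nlinarith
    | succ m ih =>
      intro x hx hx1
      by_cases hx2 : 2 * x ≤ 1
      · have h1 := ih (2 * x) (by push_cast; rw [pow_succ] at hx; linarith) hx2
        have h2 := key x
        push_cast at h1
        have h3 : (0 : ℝ) ≤ ϖ (2 * x) := NNReal.coe_nonneg _
        nlinarith
      · have h1 : (ϖ x : ℝ) ≤ ϖ 1 := by exact_mod_cast h.monotone hx1
        have h2 : (0 : ℝ) ≤ ϖ 1 := (ϖ 1).coe_nonneg
        have h3 : (1 : ℝ) < 2 * x := by exact_mod_cast not_le.mp hx2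
        nlinarith
  have base' : ∀ x : ℝ≥0, x ≤ 1 → (ϖ x : ℝ) ≤ 2 * ϖ 1 * x := by
    intro x hx
    rcases eq_or_lt_of_le (zero_le : 0 ≤ x) with rfl | hx0
    · simp [h.map_zero]
    · obtain ⟨m, hm⟩ := exists_pow_lt_of_lt_one (show (0 : ℝ) < x from hx0)
        (by norm_num : (1 / 2 : ℝ) < 1)
      refine base m x (le_trans ?_ hm.le) hx
      exact pow_le_pow_of_le_one (by norm_num) (by norm_num) (Nat.le_succ m)
  have step : ∀ n : ℕ, ∀ x : ℝ≥0, (x : ℝ) ≤ (1 / 2) ^ n →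
      (ϖ x : ℝ) ≤ (κ : ℝ) ^ n * (2 * ϖ 1) * x := by
    intro n
    induction n with
    | zero => intro x hx; simpa using base' x (by exact_mod_cast (by simpa using hx))
    | succ n ih =>
      intro x hx
      have h1 := ih (2 * x) (by push_cast; rw [pow_succ] at hx; linarith)
      have h2 := key x
      push_cast at h1
      have h3 := mul_le_mul_of_nonneg_left h1 κ.coe_nonneg
      rw [pow_succ]
      nlinarith
  have hlim : Filter.Tendsto (fun n : ℕ => (κ : ℝ) ^ n * (2 * ϖ 1)) Filter.atTop (𝓝 0) := by
    simpa using (tendsto_pow_atTop_nhds_zero_of_lt_one κ.coe_nonneg hκ1').mul_const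
      (2 * (ϖ 1 : ℝ))
  obtain ⟨n, hn⟩ := (hlim.eventually (gt_mem_nhds hε)).exists
  refine ⟨(1 / 2) ^ n, by positivity, fun x hx => (step n x ?_).trans ?_⟩
  · exact_mod_cast hx
  · exact mul_le_mul_of_nonneg_right hn.le x.coe_nonneg

theorem IsControl.mono {T T' : ℝ} {ω : ℝ → ℝ → ℝ≥0} (h : IsControl T ω) (hT : T' ≤ T) :
    IsControl T' ω where
  superadditive r s t h0 h1 h2 h3 := h.superadditive r s t h0 h1 h2 (h3.trans hT)
  diag s h0 h1 := h.diag s h0 (h1.trans hT)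
  continuous_diag s h0 h1 := (h.continuous_diag s h0 (h1.trans hT)).mono
    fun _ hp => ⟨hp.1, hp.2.1, hp.2.2.trans hT⟩

theorem IsControl.add_le {T : ℝ} {ω : ℝ → ℝ → ℝ≥0} (h : IsControl T ω) {r s t : ℝ}
    (h0 : 0 ≤ r) (h1 : r ≤ s) (h2 : s ≤ t) (h3 : t ≤ T) : (ω r s : ℝ) + ω s t ≤ ω r t := by
  exact_mod_cast h.superadditive r s t h0 h1 h2 h3

theorem IsControl.le_of_subinterval {T : ℝ} {ω : ℝ → ℝ → ℝ≥0} (h : IsControl T ω)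
    {u s t v : ℝ} (h0 : 0 ≤ u) (h1 : u ≤ s) (h2 : s ≤ t) (h3 : t ≤ v) (h4 : v ≤ T) :
    ω s t ≤ ω u v := by
  have a := h.superadditive u s t h0 h1 h2 (h3.trans h4)
  have b := h.superadditive u t v h0 (h1.trans h2) h3 h4
  exact (le_add_self.trans a).trans (le_self_add.trans b)

/-- By compactness, continuity at the diagonal is uniform. -/
theorem IsControl.exists_forall_lt {T : ℝ} {ω : ℝ → ℝ → ℝ≥0} (h : IsControl T ω) {ξ : ℝ≥0}
    (hξ : 0 < ξ) : ∃ ρ : ℝ, 0 < ρ ∧ ∀ u v : ℝ, 0 ≤ u → u ≤ v → v ≤ T → v - u < ρ → ω u v < ξ := by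
  have loc : ∀ s : Set.Icc (0 : ℝ) T, ∃ r : ℝ, 0 < r ∧ ∀ u v : ℝ, 0 ≤ u → u ≤ v → v ≤ T →
      u ∈ Metric.ball (s : ℝ) r → v ∈ Metric.ball (s : ℝ) r → ω u v < ξ := by
    intro s
    have hc := h.continuous_diag s s.2.1 s.2.2
    have he : ∀ᶠ p in 𝓝[{p : ℝ × ℝ | 0 ≤ p.1 ∧ p.1 ≤ p.2 ∧ p.2 ≤ T}] ((s : ℝ), (s : ℝ)),
        ω p.1 p.2 < ξ := by
      refine hc.eventually (gt_mem_nhds ?_)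
      simpa [h.diag s s.2.1 s.2.2] using hξ
    obtain ⟨r, hr, hb⟩ := Metric.mem_nhdsWithin_iff.mp he
    refine ⟨r, hr, fun u v h0 h1 h2 hu hv => ?_⟩
    have : (u, v) ∈ {p : ℝ × ℝ | ω p.1 p.2 < ξ} := hb ⟨by
      rw [Metric.mem_ball, Prod.dist_eq]; exact max_lt hu hv, h0, h1, h2⟩
    exact this
  choose r hr hloc using loc
  obtain ⟨ρ, hρ, hleb⟩ := lebesgue_number_lemma_of_metric (s := Set.Icc (0 : ℝ) T)
    (c := fun s : Set.Icc (0 : ℝ) T => Metric.ball (s : ℝ) (r s)) isCompact_Icc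
    (fun _ => Metric.isOpen_ball)
    (fun x hx => Set.mem_iUnion.mpr ⟨⟨x, hx⟩, Metric.mem_ball_self (hr ⟨x, hx⟩)⟩)
  refine ⟨ρ, hρ, fun u v h0 h1 h2 h3 => ?_⟩
  obtain ⟨s, hs⟩ := hleb u ⟨h0, h1.trans h2⟩
  refine hloc s u v h0 h1 h2 (hs (Metric.mem_ball_self hρ)) (hs ?_)
  rw [Metric.mem_ball, Real.dist_eq, abs_of_nonneg (by linarith)]
  exact h3

/-- On short intervals the remainder is a small fraction of the control. -/
theorem exists_forall_remainder_le {T : ℝ} {ω : ℝ → ℝ → ℝ≥0} {ϖ : ℝ≥0 → ℝ≥0}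
    (hω : IsControl T ω) (hϖ : IsRemainder ϖ) {ε : ℝ} (hε : 0 < ε) :
    ∃ ρ : ℝ, 0 < ρ ∧ ∀ u v : ℝ, 0 ≤ u → u ≤ v → v ≤ T → v - u < ρ →
      (ϖ (ω u v) : ℝ) ≤ ε * ω u v := by
  obtain ⟨ξ, hξ, h⟩ := hϖ.eventually_le_mul hε
  obtain ⟨ρ, hρ, h'⟩ := hω.exists_forall_lt hξ
  exact ⟨ρ, hρ, fun u v h0 h1 h2 h3 => h _ (h' u v h0 h1 h2 h3).le⟩

theorem tendsto_remainder_horizon {T : ℝ} (hT : 0 < T) {ω : ℝ → ℝ → ℝ≥0} {ϖ : ℝ≥0 → ℝ≥0}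
    (hω : IsControl T ω) (hϖ : IsRemainder ϖ) :
    Filter.Tendsto (fun t => (ϖ (ω 0 t) : ℝ)) (𝓝[>] 0) (𝓝 0) := by
  have h1 : Filter.Tendsto (fun t => ω 0 t) (𝓝[>] 0) (𝓝 0) := by
    have hc := hω.continuous_diag 0 le_rfl hT.le
    have hp : Filter.Tendsto (fun t : ℝ => ((0 : ℝ), t)) (𝓝[>] 0)
        (𝓝[{p : ℝ × ℝ | 0 ≤ p.1 ∧ p.1 ≤ p.2 ∧ p.2 ≤ T}] ((0 : ℝ), (0 : ℝ))) := by
      refine tendsto_nhdsWithin_iff.mpr ⟨?_, ?_⟩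
      · exact ((Continuous.prodMk_right (0 : ℝ)).tendsto 0).mono_left nhdsWithin_le_nhds
      · filter_upwards [Ioc_mem_nhdsGT hT] with t ht
        exact ⟨le_rfl, ht.1.le, ht.2⟩
    have := hc.tendsto.comp hp
    simpa [Function.comp_def, hω.diag 0 le_rfl hT.le] using this
  have h2 := (hϖ.continuous.tendsto 0).comp h1
  rw [hϖ.map_zero] at h2
  simpa [Function.comp_def] using NNReal.tendsto_coe.mpr h2

/-! ### Products along finite sets of times -/

section Chain

variable {W : Type*} {φ : ℝ → ℝ → W → W}

theorem chain_append (φ : ℝ → ℝ → W → W) (t u : ℝ) (l₂ : List ℝ) :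
    ∀ (l₁ : List ℝ) (s : ℝ), chain φ t s (l₁ ++ u :: l₂) = chain φ t u l₂ ∘ chain φ u s l₁
  | [], _ => rfl
  | r :: l, s => by
    simp only [List.cons_append, chain]
    rw [chain_append φ t u l₂ l r]
    rfl

theorem chain_eq_of_forall_mem_endpoints {s t : ℝ} (hs : φ s s = id) (ht : φ t t = id) :
    ∀ l : List ℝ, l.Pairwise (· ≤ ·) → s ≤ t → (∀ r ∈ l, r = s ∨ r = t) →
      chain φ t s l = φ t s
  | [], _, _, _ => rfl
  | r :: l, hl, hst, hmem => by
    rw [List.pairwise_cons] at hl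
    rcases hmem r (by simp) with rfl | rfl
    · simp only [chain]
      rw [chain_eq_of_forall_mem_endpoints hs ht l hl.2 hst
        fun x hx => hmem x (by simp [hx]), hs, Function.comp_id]
    · simp only [chain]
      rw [chain_eq_of_forall_mem_endpoints ht ht l hl.2 le_rfl fun x hx => ?_, ht,
        Function.id_comp]
      rcases hmem x (by simp [hx]) with rfl | rfl
      · exact Or.inl (le_antisymm hst (hl.1 _ hx))
      · exact Or.inl rfl

theorem iteratedProduct_eq_of_forall_notMem {σ : Finset ℝ} {s t : ℝ} (hst : s ≤ t)
    (hs : φ s s = id) (ht : φ t t = id) (hσ : ∀ w ∈ σ, ¬(s < w ∧ w < t)) :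
    iteratedProduct φ σ t s = φ t s := by
  refine chain_eq_of_forall_mem_endpoints hs ht _ (Finset.pairwise_sort _ _) hst fun r hr => ?_
  simp only [Finset.mem_sort, Finset.mem_filter] at hr
  by_contra hne
  rw [not_or] at hne
  exact hσ r hr.1 ⟨lt_of_le_of_ne hr.2.1 (Ne.symm hne.1), lt_of_le_of_ne hr.2.2 hne.2⟩

theorem sort_filter_eq_append {σ : Finset ℝ} {s u t : ℝ} (hsu : s ≤ u) (hut : u ≤ t)
    (hu : u ∈ σ) :
    (σ.filter (fun x => s ≤ x ∧ x ≤ t)).sort (· ≤ ·) =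
      (σ.filter (fun x => s ≤ x ∧ x < u)).sort (· ≤ ·) ++
        u :: (σ.filter (fun x => u < x ∧ x ≤ t)).sort (· ≤ ·) := by
  have hsorted : ((σ.filter (fun x => s ≤ x ∧ x < u)).sort (· ≤ ·) ++
      u :: (σ.filter (fun x => u < x ∧ x ≤ t)).sort (· ≤ ·)).Pairwise (· < ·) := by
    rw [List.pairwise_append, List.pairwise_cons]
    refine ⟨Finset.sortedLT_sort _ |>.pairwise, ⟨?_, Finset.sortedLT_sort _ |>.pairwise⟩, ?_⟩
    · intro x hx
      simp only [Finset.mem_sort, Finset.mem_filter] at hx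
      exact hx.2.1
    · intro x hx y hy
      simp only [Finset.mem_sort, Finset.mem_filter, List.mem_cons] at hx hy
      rcases hy with rfl | hy
      · exact hx.2.2
      · exact hx.2.2.trans hy.2.1
  refine List.Perm.eq_of_pairwise (le := (· ≤ ·)) (fun a b _ _ h h' => le_antisymm h h')
    (Finset.pairwise_sort _ _) (hsorted.imp le_of_lt) ?_
  refine (List.perm_ext_iff_of_nodup (Finset.sort_nodup _ _) (hsorted.imp ne_of_lt)).mpr ?_
  intro x
  simp only [Finset.mem_sort, Finset.mem_filter, List.mem_append, List.mem_cons]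
  constructor
  · rintro ⟨hx, h1, h2⟩
    rcases lt_trichotomy x u with h | h | h
    · exact Or.inl ⟨hx, h1, h⟩
    · exact Or.inr (Or.inl h)
    · exact Or.inr (Or.inr ⟨hx, h, h2⟩)
  · rintro (⟨hx, h1, h2⟩ | rfl | ⟨hx, h1, h2⟩)
    · exact ⟨hx, h1, h2.le.trans hut⟩
    · exact ⟨hu, hsu, hut⟩
    · exact ⟨hx, hsu.trans h1.le, h2⟩

theorem iteratedProduct_comp {σ : Finset ℝ} {s u t : ℝ} (hsu : s ≤ u) (hut : u ≤ t)
    (hu : u ∈ σ) (hid : φ u u = id) :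
    iteratedProduct φ σ t u ∘ iteratedProduct φ σ u s = iteratedProduct φ σ t s := by
  have empty_of : ∀ p : ℝ → Prop, ∀ [DecidablePred p], (∀ x, ¬p x) →
      (σ.filter p).sort (· ≤ ·) = [] := by
    intro p _ hp
    rw [Finset.filter_false_of_mem fun x _ => hp x, Finset.sort_empty]
  unfold iteratedProduct
  rw [sort_filter_eq_append hsu hut hu, sort_filter_eq_append hsu le_rfl hu,
    sort_filter_eq_append le_rfl hut hu, chain_append, chain_append, chain_append,
    empty_of (fun x => u < x ∧ x ≤ u) fun x h => absurd h.1 (not_lt.mpr h.2),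
    empty_of (fun x => u ≤ x ∧ x < u) fun x h => absurd h.2 (not_lt.mpr h.1)]
  simp only [chain, hid, Function.id_comp, Function.comp_id]

end Chain

/-! ### Comparison of two families along a finite set of times -/

section Compare

variable {V : Type*} [NormedAddCommGroup V]

theorem exists_min_between {σ : Finset ℝ} {s t : ℝ} (h : ∃ w ∈ σ, s < w ∧ w < t) :
    ∃ u ∈ σ, s < u ∧ u < t ∧ (∀ w ∈ σ, ¬(s < w ∧ w < u)) := by
  have hne : (σ.filter (fun w => s < w ∧ w < t)).Nonempty := by
    obtain ⟨w, hw, h⟩ := h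
    exact ⟨w, Finset.mem_filter.mpr ⟨hw, h⟩⟩
  have hm := Finset.min'_mem _ hne
  rw [Finset.mem_filter] at hm
  refine ⟨_, hm.1, hm.2.1, hm.2.2, fun w hw hlt => ?_⟩
  exact absurd (Finset.min'_le _ w (Finset.mem_filter.mpr ⟨hw, hlt.1, hlt.2.trans hm.2.2⟩))
    (not_le.mpr hlt.2)

theorem card_between_lt {σ : Finset ℝ} {s t s' t' x : ℝ} (hx : x ∈ σ) (hsx : s < x) (hxt : x < t)
    (hs : s ≤ s') (ht : t' ≤ t) (hnot : ¬(s' < x ∧ x < t')) :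
    (σ.filter (fun w => s' < w ∧ w < t')).card < (σ.filter (fun w => s < w ∧ w < t)).card := by
  refine Finset.card_lt_card ⟨fun w hw => ?_, fun hsub => ?_⟩
  · simp only [Finset.mem_filter] at hw ⊢
    exact ⟨hw.1, hs.trans_lt hw.2.1, hw.2.2.trans_le ht⟩
  · have := hsub (Finset.mem_filter.mpr ⟨hx, hsx, hxt⟩)
    exact hnot (Finset.mem_filter.mp this).2

/-- Telescoping. Both families split at the points of `σ`; the errors made on the successive
intervals are transported by the maps of `Y`, so that a uniform Lipschitz bound for `Y` suffices to
add them up. -/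
theorem norm_sub_le_of_adjacent {T : ℝ} {ω : ℝ → ℝ → ℝ≥0} (hω : IsControl T ω) (σ : Finset ℝ)
    {X Y : ℝ → ℝ → V → V} {K c : ℝ} (hK : 1 ≤ K) (hc : 0 ≤ c)
    (hX : ∀ s u t : ℝ, 0 ≤ s → s ≤ u → u ≤ t → t ≤ T → u ∈ σ → X t u ∘ X u s = X t s)
    (hY : ∀ s u t : ℝ, 0 ≤ s → s ≤ u → u ≤ t → t ≤ T → u ∈ σ → Y t u ∘ Y u s = Y t s)
    (hLip : ∀ s t : ℝ, 0 ≤ s → s ≤ t → t ≤ T → ∀ a b : V, ‖Y t s a - Y t s b‖ ≤ K * ‖a - b‖)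
    (hadj : ∀ s t : ℝ, 0 ≤ s → s ≤ t → t ≤ T → (∀ w ∈ σ, ¬(s < w ∧ w < t)) →
      ∀ a : V, ‖X t s a - Y t s a‖ ≤ c * ω s t) :
    ∀ s t : ℝ, 0 ≤ s → s ≤ t → t ≤ T → ∀ a : V, ‖X t s a - Y t s a‖ ≤ K * c * ω s t := by
  intro s t
  induction hn : (σ.filter (fun w => s < w ∧ w < t)).card using Nat.strong_induction_on
    generalizing s t with
  | _ n ih =>
    intro h0 hst hT a
    by_cases hex : ∃ w ∈ σ, s < w ∧ w < t
    · obtain ⟨u, hu, hsu, hut, hno⟩ := exists_min_between hex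
      have h1 := ih _ (hn ▸ card_between_lt hu hsu hut hsu.le le_rfl (fun h => lt_irrefl _ h.1))
        u t rfl (h0.trans hsu.le) hut.le hT (X u s a)
      have h2 := hadj s u h0 hsu.le (hut.le.trans hT) hno a
      have h3 := hLip u t (h0.trans hsu.le) hut.le hT (X u s a) (Y u s a)
      have hXe : X t s a = X t u (X u s a) := by
        rw [← hX s u t h0 hsu.le hut.le hT hu]; rfl
      have hYe : Y t s a = Y t u (Y u s a) := by
        rw [← hY s u t h0 hsu.le hut.le hT hu]; rfl
      have h4 := norm_sub_le_norm_sub_add_norm_sub (X t u (X u s a)) (Y t u (X u s a))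
        (Y t u (Y u s a))
      have h5 := hω.add_le h0 hsu.le hut.le hT
      have h6 := mul_le_mul_of_nonneg_left h2 (zero_le_one.trans hK)
      have h7 := mul_le_mul_of_nonneg_left h5 (mul_nonneg (zero_le_one.trans hK) hc)
      rw [hXe, hYe]
      linarith
    · have h1 := hadj s t h0 hst hT (fun w hw h => hex ⟨w, hw, h⟩) a
      have h2 : c * (ω s t : ℝ) ≤ K * (c * ω s t) :=
        le_mul_of_one_le_left (mul_nonneg hc (ω s t).coe_nonneg) hK
      linarith

end Compare

/-! ### The discrete sewing estimates -/

section Estimates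

variable {V : Type*} [NormedAddCommGroup V]

/-- The estimates on `[0, T]` that the construction of the flow uses: `φ t s - id` is
`ε`-Lipschitz, the defect of the composition rule is small in the sup-norm and in the Lipschitz
seminorm, and the 4-points control holds on all subintervals of `[r, t]` at the scale
`α ϖ(ω_{r,t})`, with the constant `Φ α`. -/
structure StableOn (T : ℝ) (ω : ℝ → ℝ → ℝ≥0) (ϖ : ℝ≥0 → ℝ≥0) (ε : ℝ) (M C : ℝ≥0)
    (Φ : ℝ≥0 → ℝ≥0) (φ : ℝ → ℝ → V → V) : Prop where
  diag : ∀ t : ℝ, 0 ≤ t → t ≤ T → φ t t = id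
  near_id : ∀ s t : ℝ, 0 ≤ s → s ≤ t → t ≤ T → ∀ a b : V,
    ‖(φ t s a - a) - (φ t s b - b)‖ ≤ ε * ‖a - b‖
  defect : ∀ r s t : ℝ, 0 ≤ r → r ≤ s → s ≤ t → t ≤ T → ∀ a : V,
    ‖φ t s (φ s r a) - φ t r a‖ ≤ M * ϖ (ω r t)
  lipschitz_defect : ∀ r s t : ℝ, 0 ≤ r → r ≤ s → s ≤ t → t ≤ T → ∀ a b : V,
    ‖(φ t s (φ s r a) - φ t r a) - (φ t s (φ s r b) - φ t r b)‖ ≤ C * ϖ (ω r t) * ‖a - b‖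
  fourPoints : ∀ α : ℝ≥0, ∀ r s s' t : ℝ, 0 ≤ r → r ≤ s → s ≤ s' → s' ≤ t → t ≤ T →
    ∀ a b c d : V, ‖a - b‖ ≤ α * ϖ (ω r t) → ‖c - d‖ ≤ α * ϖ (ω r t) →
    ‖φ s' s a - φ s' s b - φ s' s c + φ s' s d‖ ≤
      Φ α * ϖ (ω r t) * max ‖a - c‖ ‖b - d‖ + (1 + ε) * ‖a - b - c + d‖

variable {T : ℝ} {ω : ℝ → ℝ → ℝ≥0} {ϖ : ℝ≥0 → ℝ≥0} {ε : ℝ} {M C : ℝ≥0} {Φ : ℝ≥0 → ℝ≥0}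
  {φ : ℝ → ℝ → V → V}

theorem StableOn.norm_sub_le (h : StableOn T ω ϖ ε M C Φ φ) {s t : ℝ} (h0 : 0 ≤ s) (hst : s ≤ t)
    (hT : t ≤ T) (a b : V) : ‖φ t s a - φ t s b‖ ≤ (1 + ε) * ‖a - b‖ := by
  have h1 := h.near_id s t h0 hst hT a b
  have h2 := norm_add_le ((φ t s a - a) - (φ t s b - b)) (a - b)
  rw [show (φ t s a - a) - (φ t s b - b) + (a - b) = φ t s a - φ t s b by abel] at h2
  linarith

/-- The points of `σ` in `(s, t)` can be cut at two times, between which `σ` has no point, such that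
the control of either outer interval is at most half of the control of `[s, t]`. The control need
not be continuous off the diagonal, so that one cutting time would not do. -/
theorem exists_split (hω : IsControl T ω) {σ : Finset ℝ} {s t : ℝ} (h0 : 0 ≤ s) (hT : t ≤ T)
    (hex : ∃ w ∈ σ, s < w ∧ w < t) :
    ∃ u v : ℝ, s ≤ u ∧ u ≤ v ∧ v ≤ t ∧ (u = s ∨ u ∈ σ) ∧ (v = t ∨ v ∈ σ) ∧
      2 * ω s u ≤ ω s t ∧ 2 * ω v t ≤ ω s t ∧ (∀ w ∈ σ, ¬(u < w ∧ w < v)) ∧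
      (σ.filter (fun w => s < w ∧ w < u)).card < (σ.filter (fun w => s < w ∧ w < t)).card ∧
      (σ.filter (fun w => v < w ∧ w < t)).card < (σ.filter (fun w => s < w ∧ w < t)).card := by
  obtain ⟨x, hx, hsx, hxt⟩ := hex
  have hst : s < t := hsx.trans hxt
  set A := (insert s (σ.filter (fun w => s < w ∧ w < t))).filter
    (fun w => 2 * ω s w ≤ ω s t) with hA
  have hsA : s ∈ A := by
    simp [hA, hω.diag s h0 (hst.le.trans hT)]
  have hmem := Finset.max'_mem A ⟨s, hsA⟩
  set u := A.max' ⟨s, hsA⟩ with hu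
  have hmax : ∀ w ∈ A, w ≤ u := fun w hw => Finset.le_max' A w hw
  rw [hA, Finset.mem_filter, Finset.mem_insert, Finset.mem_filter] at hmem
  obtain ⟨hmem, hhalf⟩ := hmem
  have hsu : s ≤ u := hmax s hsA
  have hut : u < t := by
    rcases hmem with h | h
    · rw [h]; exact hst
    · exact h.2.2
  have huσ : u = s ∨ u ∈ σ := hmem.imp id And.left
  have hcard : (σ.filter (fun w => s < w ∧ w < u)).card <
      (σ.filter (fun w => s < w ∧ w < t)).card := by
    rcases hmem with h | h
    · exact card_between_lt hx hsx hxt le_rfl hut.le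
        fun h' => absurd (h'.1.trans h'.2) (by rw [h]; exact lt_irrefl _)
    · exact card_between_lt h.1 h.2.1 h.2.2 le_rfl hut.le fun h' => lt_irrefl _ h'.2
  by_cases hex : ∃ w ∈ σ, u < w ∧ w < t
  · obtain ⟨v, hv, huv, hvt, hno⟩ := exists_min_between hex
    have hsv : s < v := hsu.trans_lt huv
    refine ⟨u, v, hsu, huv.le, hvt.le, huσ, Or.inr hv, hhalf, ?_, hno, hcard,
      card_between_lt hv hsv hvt hsv.le le_rfl fun h' => lt_irrefl _ h'.1⟩
    have hvA : ω s t < 2 * ω s v := by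
      by_contra hle
      refine absurd (hmax v ?_) (not_le.mpr huv)
      simp only [hA, Finset.mem_filter, Finset.mem_insert]
      exact ⟨Or.inr ⟨hv, hsv, hvt⟩, not_lt.mp hle⟩
    have h1 := hω.add_le h0 hsv.le hvt.le hT
    have h2 : (ω s t : ℝ) < 2 * ω s v := by exact_mod_cast hvA
    have h3 : (2 : ℝ) * ω v t ≤ ω s t := by linarith
    exact_mod_cast h3
  · refine ⟨u, t, hsu, hut.le, le_rfl, huσ, Or.inl rfl, hhalf, ?_,
      fun w hw h' => hex ⟨w, hw, h'⟩, hcard,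
      card_between_lt hx hsx hxt hst.le le_rfl fun h' => lt_irrefl _ (h'.1.trans h'.2)⟩
    rw [hω.diag t (h0.trans hst.le) hT]
    simp

/-- Induction principle for iterated products: a property of maps that holds for `φ` and is stable
under composition across a split of the interval holds for all iterated products. -/
theorem iteratedProduct_induction {W : Type*} {φ : ℝ → ℝ → W → W} (hω : IsControl T ω)
    (σ : Finset ℝ)
    (hdiag : ∀ t : ℝ, 0 ≤ t → t ≤ T → φ t t = id) (Q : ℝ → ℝ → (W → W) → Prop)
    (hbase : ∀ s t : ℝ, 0 ≤ s → s ≤ t → t ≤ T → Q s t (φ t s))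
    (hstep : ∀ s u v t : ℝ, 0 ≤ s → s ≤ u → u ≤ v → v ≤ t → t ≤ T →
      2 * ω s u ≤ ω s t → 2 * ω v t ≤ ω s t →
      Q s u (iteratedProduct φ σ u s) → Q v t (iteratedProduct φ σ t v) →
      Q s t (iteratedProduct φ σ t v ∘ φ v u ∘ iteratedProduct φ σ u s)) :
    ∀ s t : ℝ, 0 ≤ s → s ≤ t → t ≤ T → Q s t (iteratedProduct φ σ t s) := by
  intro s t
  induction hn : (σ.filter (fun w => s < w ∧ w < t)).card using Nat.strong_induction_on
    generalizing s t with
  | _ n ih =>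
    intro h0 hst hT
    by_cases hex : ∃ w ∈ σ, s < w ∧ w < t
    · obtain ⟨u, v, hsu, huv, hvt, hu, hv, hω1, hω2, hno, hc1, hc2⟩ := exists_split hω h0 hT hex
      have hu0 := h0.trans hsu
      have hv0 := hu0.trans huv
      have hvT := hvt.trans hT
      have huT := huv.trans hvT
      have self : ∀ r : ℝ, 0 ≤ r → r ≤ T → iteratedProduct φ σ r r = id := fun r h1 h2 => by
        rw [iteratedProduct_eq_of_forall_notMem le_rfl (hdiag r h1 h2) (hdiag r h1 h2)
          fun w _ h' => lt_irrefl _ (h'.1.trans h'.2), hdiag r h1 h2]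
      have e1 : iteratedProduct φ σ v u ∘ iteratedProduct φ σ u s = iteratedProduct φ σ v s := by
        rcases hu with rfl | hu
        · rw [self _ h0 huT, Function.comp_id]
        · exact iteratedProduct_comp hsu huv hu (hdiag u hu0 huT)
      have e2 : iteratedProduct φ σ t v ∘ iteratedProduct φ σ v s = iteratedProduct φ σ t s := by
        rcases hv with rfl | hv
        · rw [self _ hv0 hT, Function.id_comp]
        · exact iteratedProduct_comp (hsu.trans huv) hvt hv (hdiag v hv0 hvT)
      rw [← e2, ← e1, iteratedProduct_eq_of_forall_notMem huv (hdiag u hu0 huT)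
        (hdiag v hv0 hvT) hno]
      exact hstep s u v t h0 hsu huv hvt hT hω1 hω2
        (ih _ (hn ▸ hc1) s u rfl h0 hsu huT) (ih _ (hn ▸ hc2) v t rfl hv0 hvt hT)
    · rw [iteratedProduct_eq_of_forall_notMem hst (hdiag s h0 (hst.trans hT))
        (hdiag t (h0.trans hst) hT) fun w hw h' => hex ⟨w, hw, h'⟩]
      exact hbase s t h0 hst hT

theorem remainder_le_of_subinterval (hω : IsControl T ω) (hϖ : IsRemainder ϖ)
    {u s t v : ℝ} (h0 : 0 ≤ u) (h1 : u ≤ s) (h2 : s ≤ t) (h3 : t ≤ v) (h4 : v ≤ T) :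
    (ϖ (ω s t) : ℝ) ≤ ϖ (ω u v) := by
  exact_mod_cast hϖ.monotone (hω.le_of_subinterval h0 h1 h2 h3 h4)

/-- Sup-norm estimate. Halving the control gains the factor `κ / 2` on each of the two outer
pieces, which beats the Lipschitz constant of `φ` since `κ (1 + ε) (1 + 2ε) < 1`. -/
theorem StableOn.norm_iteratedProduct_sub_le (h : StableOn T ω ϖ ε M C Φ φ)
    (hω : IsControl T ω) (hϖ : IsRemainder ϖ) {κ : ℝ≥0}
    (hκ : ∀ x : ℝ≥0, 0 < x → 2 * ϖ (x / 2) ≤ κ * ϖ x) (hε0 : 0 ≤ ε) (hε1 : ε ≤ 1 / 4)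
    {κ' : ℝ} (hκ' : (1 + ε) * (1 + 2 * ε) * κ ≤ κ') {L₀ : ℝ≥0} (hL₀ : 3 * M ≤ (1 - κ') * L₀)
    (σ : Finset ℝ) {s t : ℝ} (h0 : 0 ≤ s) (hst : s ≤ t) (hT : t ≤ T) (a : V) :
    ‖iteratedProduct φ σ t s a - φ t s a‖ ≤ L₀ * ϖ (ω s t) := by
  refine iteratedProduct_induction hω σ h.diag
    (fun s t F => ∀ a, ‖F a - φ t s a‖ ≤ L₀ * ϖ (ω s t)) ?_ ?_ s t h0 hst hT a
  · intro s t _ _ _ a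
    rw [sub_self, norm_zero]
    positivity
  · intro s u v t h0 hsu huv hvt hT hω1 hω2 hg hf a
    set f := iteratedProduct φ σ t v
    set g := iteratedProduct φ σ u s
    have hu0 := h0.trans hsu
    have hv0 := hu0.trans huv
    have hvT := hvt.trans hT
    have k1 := hϖ.two_mul_le hκ hω1
    have k2 := hϖ.two_mul_le hκ hω2
    have k3 := remainder_le_of_subinterval hω hϖ h0 le_rfl (hsu.trans huv) hvt hT
    have b1 := hf (φ v u (g a))
    have b2 := h.norm_sub_le hv0 hvt hT (φ v u (g a)) (φ v s a)
    have b3 := h.norm_sub_le hu0 huv hvT (g a) (φ u s a)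
    have b4 := hg a
    have b5 := h.defect s u v h0 hsu huv hvT a
    have b6 := h.defect s v t h0 (hsu.trans huv) hvt hT a
    have b7 := norm_sub_le_norm_sub_add_norm_sub (φ v u (g a)) (φ v u (φ u s a)) (φ v s a)
    have b8 := norm_sub_le_norm_sub_add_norm_sub (f (φ v u (g a))) (φ t v (φ v u (g a)))
      (φ t s a)
    have b9 := norm_sub_le_norm_sub_add_norm_sub (φ t v (φ v u (g a))) (φ t v (φ v s a))
      (φ t s a)
    simp only [Function.comp_apply]
    set θ : ℝ := NNReal.toReal (ϖ (ω s t))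
    have hθ0 : 0 ≤ θ := NNReal.coe_nonneg _
    have hκ0 : (0 : ℝ) ≤ κ := κ.coe_nonneg
    have hM : (0 : ℝ) ≤ M := M.coe_nonneg
    have hL : (0 : ℝ) ≤ L₀ := L₀.coe_nonneg
    have c1 : (L₀ : ℝ) * ϖ (ω s u) ≤ L₀ * (κ * θ / 2) :=
      mul_le_mul_of_nonneg_left (by linarith) hL
    have c2 : (L₀ : ℝ) * ϖ (ω v t) ≤ L₀ * (κ * θ / 2) :=
      mul_le_mul_of_nonneg_left (by linarith) hL
    have c3 : (M : ℝ) * ϖ (ω s v) ≤ M * θ := mul_le_mul_of_nonneg_left k3 hM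
    have d1 : ‖φ v u (g a) - φ v s a‖ ≤ (1 + ε) * (L₀ * (κ * θ / 2)) + M * θ := by
      have := mul_le_mul_of_nonneg_left (b4.trans c1) (by linarith : 0 ≤ 1 + ε)
      linarith
    have d2 := mul_le_mul_of_nonneg_left d1 (by linarith : 0 ≤ 1 + ε)
    have e1 : L₀ * (κ * θ / 2) + (1 + ε) * ((1 + ε) * (L₀ * (κ * θ / 2))) ≤ κ' * (L₀ * θ) := by
      have q : (1 + (1 + ε) * (1 + ε)) / 2 * κ ≤ κ' := by
        refine le_trans (mul_le_mul_of_nonneg_right ?_ hκ0) hκ'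
        nlinarith
      have := mul_le_mul_of_nonneg_right q (mul_nonneg hL hθ0)
      linarith
    have e2 := mul_le_mul_of_nonneg_right hL₀ hθ0
    have e3 : ε * (M * θ) ≤ 1 * (M * θ) :=
      mul_le_mul_of_nonneg_right (by linarith) (mul_nonneg hM hθ0)
    linarith

/-- Lipschitz estimate. As for the sup-norm, but the difference of `φ t v ∘ F` and `φ t v ∘ G`
is estimated by the 4-points control, at the scale that the sup-norm estimate provides. The bound
`L₁ ϖ(ω_{0,T}) ≤ ε` keeps the products `(1 + 2ε)`-Lipschitz throughout the induction. -/
theorem StableOn.norm_iteratedProduct_sub_sub_le (h : StableOn T ω ϖ ε M C Φ φ)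
    (hω : IsControl T ω) (hϖ : IsRemainder ϖ) {κ : ℝ≥0}
    (hκ : ∀ x : ℝ≥0, 0 < x → 2 * ϖ (x / 2) ≤ κ * ϖ x) (hε0 : 0 ≤ ε) (hε1 : ε ≤ 1 / 4)
    {κ' : ℝ} (hκ' : (1 + ε) * (1 + 2 * ε) * κ ≤ κ') {L₀ L₁ : ℝ≥0}
    (hL₀ : 3 * M ≤ (1 - κ') * L₀) (hL₁ : 5 * Φ (2 * L₀ + M) + 3 * C ≤ (1 - κ') * L₁)
    (hL₁ε : L₁ * ϖ (ω 0 T) ≤ ε)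
    (σ : Finset ℝ) {s t : ℝ} (h0 : 0 ≤ s) (hst : s ≤ t) (hT : t ≤ T) (a b : V) :
    ‖(iteratedProduct φ σ t s a - φ t s a) - (iteratedProduct φ σ t s b - φ t s b)‖ ≤
      L₁ * ϖ (ω s t) * ‖a - b‖ := by
  refine iteratedProduct_induction hω σ h.diag
    (fun s t F => ∀ a b, ‖(F a - φ t s a) - (F b - φ t s b)‖ ≤ L₁ * ϖ (ω s t) * ‖a - b‖)
    ?_ ?_ s t h0 hst hT a b
  · intro s t _ _ _ a b
    rw [sub_self, sub_self, sub_self, norm_zero]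
    positivity
  · intro s u v t h0 hsu huv hvt hT hω1 hω2 hg hf a b
    have hg0 : ∀ a, ‖iteratedProduct φ σ u s a - φ u s a‖ ≤ L₀ * ϖ (ω s u) := fun a =>
      h.norm_iteratedProduct_sub_le hω hϖ hκ hε0 hε1 hκ' hL₀ σ h0 hsu
        (huv.trans (hvt.trans hT)) a
    set f := iteratedProduct φ σ t v
    set g := iteratedProduct φ σ u s
    have hu0 := h0.trans hsu
    have hv0 := hu0.trans huv
    have hvT := hvt.trans hT
    have huT := huv.trans hvT
    have k1 := hϖ.two_mul_le hκ hω1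
    have k2 := hϖ.two_mul_le hκ hω2
    have k3 := remainder_le_of_subinterval hω hϖ h0 le_rfl (hsu.trans huv) hvt hT
    have k4 := remainder_le_of_subinterval hω hϖ h0 le_rfl hsu (huv.trans hvt) hT
    have k5 := remainder_le_of_subinterval hω hϖ le_rfl h0 hsu huT le_rfl
    have hM : (0 : ℝ) ≤ M := M.coe_nonneg
    have hC : (0 : ℝ) ≤ C := C.coe_nonneg
    have hL : (0 : ℝ) ≤ L₀ := L₀.coe_nonneg
    have hL' : (0 : ℝ) ≤ L₁ := L₁.coe_nonneg
    have hκ0 : (0 : ℝ) ≤ κ := κ.coe_nonneg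
    set Ψ : ℝ := NNReal.toReal (Φ (2 * L₀ + M))
    have hΨ0 : 0 ≤ Ψ := NNReal.coe_nonneg _
    set θ : ℝ := NNReal.toReal (ϖ (ω s t))
    have hθ0 : 0 ≤ θ := NNReal.coe_nonneg _
    set n : ℝ := ‖a - b‖
    have hn0 : 0 ≤ n := norm_nonneg _
    -- Lipschitz bounds for the inner maps
    have l1 : ‖φ u s a - φ u s b‖ ≤ (1 + ε) * n := h.norm_sub_le h0 hsu huT a b
    have l2 : ‖g a - g b‖ ≤ (1 + 2 * ε) * n := by
      have e1 := norm_add_le ((g a - φ u s a) - (g b - φ u s b)) (φ u s a - φ u s b)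
      rw [show (g a - φ u s a) - (g b - φ u s b) + (φ u s a - φ u s b) = g a - g b by abel] at e1
      have e2 := hg a b
      have e3 : L₁ * ϖ (ω s u) * n ≤ ε * n :=
        mul_le_mul_of_nonneg_right ((mul_le_mul_of_nonneg_left k5 hL').trans hL₁ε) hn0
      linarith only [e1, e2, e3, l1]
    have l3 : ‖φ v s a - φ v s b‖ ≤ (1 + ε) * n :=
      h.norm_sub_le h0 (hsu.trans huv) hvT a b
    have l4 : ‖φ v u (g a) - φ v u (g b)‖ ≤ (1 + ε) * (1 + 2 * ε) * n := by
      have e1 := h.norm_sub_le hu0 huv hvT (g a) (g b)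
      have e2 := mul_le_mul_of_nonneg_left l2 (by linarith only [hε0] : 0 ≤ 1 + ε)
      linarith only [e1, e2]
    have hsq : (1 + ε) * (1 + 2 * ε) ≤ 2 := by nlinarith only [hε0, hε1]
    have m1 : max ‖g a - g b‖ ‖φ u s a - φ u s b‖ ≤ 2 * n :=
      max_le (l2.trans (mul_le_mul_of_nonneg_right (by linarith only [hε0, hε1]) hn0))
        (l1.trans (mul_le_mul_of_nonneg_right (by linarith only [hε0, hε1]) hn0))
    have m2 : max ‖φ v u (g a) - φ v u (g b)‖ ‖φ v s a - φ v s b‖ ≤ 2 * n :=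
      max_le (l4.trans (mul_le_mul_of_nonneg_right hsq hn0))
        (l3.trans (mul_le_mul_of_nonneg_right (by linarith only [hε0, hε1]) hn0))
    -- both applications of the 4-points control use the scale `(2 L₀ + M) ϖ(ω_{s,t})`
    have s1 : ∀ x, ‖g x - φ u s x‖ ≤ (2 * L₀ + M : ℝ≥0) * θ := fun x => by
      refine (hg0 x).trans ?_
      push_cast
      have e1 := mul_le_mul_of_nonneg_left k4 hL
      have e2 := mul_nonneg hM hθ0
      have e3 := mul_nonneg hL hθ0
      linarith only [e1, e2, e3]
    have s2 : ∀ x, ‖φ v u (g x) - φ v s x‖ ≤ (2 * L₀ + M : ℝ≥0) * θ := fun x => by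
      have e1 := h.norm_sub_le hu0 huv hvT (g x) (φ u s x)
      have e2 := h.defect s u v h0 hsu huv hvT x
      have e3 := norm_sub_le_norm_sub_add_norm_sub (φ v u (g x)) (φ v u (φ u s x)) (φ v s x)
      have e4 := mul_le_mul_of_nonneg_left ((hg0 x).trans (mul_le_mul_of_nonneg_left k4 hL))
        (by linarith only [hε0] : 0 ≤ 1 + ε)
      have e5 := mul_le_mul_of_nonneg_left k3 hM
      have e6 : (1 + ε) * (L₀ * θ) ≤ 2 * (L₀ * θ) :=
        mul_le_mul_of_nonneg_right (by linarith only [hε0, hε1]) (mul_nonneg hL hθ0)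
      push_cast
      linarith only [e1, e2, e3, e4, e5, e6]
    have p1 := h.fourPoints (2 * L₀ + M) s u v t h0 hsu huv hvt hT (g a) (φ u s a) (g b)
      (φ u s b) (s1 a) (s1 b)
    have p2 := h.fourPoints (2 * L₀ + M) s v t t h0 (hsu.trans huv) hvt le_rfl hT (φ v u (g a))
      (φ v s a) (φ v u (g b)) (φ v s b) (s2 a) (s2 b)
    have hΨθ : 0 ≤ Ψ * θ := mul_nonneg hΨ0 hθ0
    have p1' := mul_le_mul_of_nonneg_left m1 hΨθ
    have p2' := mul_le_mul_of_nonneg_left m2 hΨθ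
    have d1 := h.lipschitz_defect s u v h0 hsu huv hvT a b
    have d2 := h.lipschitz_defect s v t h0 (hsu.trans huv) hvt hT a b
    have d1' : C * ϖ (ω s v) * n ≤ C * θ * n :=
      mul_le_mul_of_nonneg_right (mul_le_mul_of_nonneg_left k3 hC) hn0
    have q1 : L₁ * ϖ (ω s u) * n ≤ L₁ * (κ * θ / 2) * n :=
      mul_le_mul_of_nonneg_right (mul_le_mul_of_nonneg_left (by linarith only [k1, k2]) hL') hn0
    have q2 : L₁ * ϖ (ω v t) * ‖φ v u (g a) - φ v u (g b)‖ ≤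
        L₁ * (κ * θ / 2) * ((1 + ε) * (1 + 2 * ε) * n) :=
      mul_le_mul (mul_le_mul_of_nonneg_left (by linarith only [k1, k2]) hL') l4 (norm_nonneg _)
        (mul_nonneg hL' (by positivity))
    have g1 := hg a b
    have f1 := hf (φ v u (g a)) (φ v u (g b))
    have rw1 : g a - φ u s a - g b + φ u s b = (g a - φ u s a) - (g b - φ u s b) := by abel
    rw [rw1] at p1
    -- the difference of `φ v u ∘ g` and `φ v s`
    have E1 : ‖φ v u (g a) - φ v s a - φ v u (g b) + φ v s b‖ ≤
        2 * (Ψ * θ * n) + (1 + ε) * (L₁ * (κ * θ / 2) * n) + C * θ * n := by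
      have e1 := norm_add_le
        (φ v u (g a) - φ v u (φ u s a) - φ v u (g b) + φ v u (φ u s b))
        ((φ v u (φ u s a) - φ v s a) - (φ v u (φ u s b) - φ v s b))
      rw [show φ v u (g a) - φ v u (φ u s a) - φ v u (g b) + φ v u (φ u s b) +
        ((φ v u (φ u s a) - φ v s a) - (φ v u (φ u s b) - φ v s b)) =
        φ v u (g a) - φ v s a - φ v u (g b) + φ v s b by abel] at e1
      have e2 := mul_le_mul_of_nonneg_left (g1.trans q1) (by linarith only [hε0] : 0 ≤ 1 + ε)
      linarith only [e1, e2, p1, p1', d1, d1']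
    have E2 := mul_le_mul_of_nonneg_left E1 (by linarith only [hε0] : 0 ≤ 1 + ε)
    have tri := norm_add₃_le
      (a := (f (φ v u (g a)) - φ t v (φ v u (g a))) - (f (φ v u (g b)) - φ t v (φ v u (g b))))
      (b := φ t v (φ v u (g a)) - φ t v (φ v s a) - φ t v (φ v u (g b)) + φ t v (φ v s b))
      (c := (φ t v (φ v s a) - φ t s a) - (φ t v (φ v s b) - φ t s b))
    rw [show (f (φ v u (g a)) - φ t v (φ v u (g a))) - (f (φ v u (g b)) - φ t v (φ v u (g b))) +
      (φ t v (φ v u (g a)) - φ t v (φ v s a) - φ t v (φ v u (g b)) + φ t v (φ v s b)) +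
      ((φ t v (φ v s a) - φ t s a) - (φ t v (φ v s b) - φ t s b)) =
      (f (φ v u (g a)) - φ t s a) - (f (φ v u (g b)) - φ t s b) by abel] at tri
    simp only [Function.comp_apply]
    have r1 : L₁ * (κ * θ / 2) * ((1 + ε) * (1 + 2 * ε) * n) +
        (1 + ε) * ((1 + ε) * (L₁ * (κ * θ / 2) * n)) ≤ κ' * (L₁ * θ * n) := by
      have q : ((1 + ε) * (1 + 2 * ε) + (1 + ε) * (1 + ε)) / 2 * κ ≤ κ' := by
        refine le_trans (mul_le_mul_of_nonneg_right ?_ hκ0) hκ'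
        nlinarith only [hε0]
      have := mul_le_mul_of_nonneg_right q (mul_nonneg (mul_nonneg hL' hθ0) hn0)
      linarith only [this]
    have r2 := mul_le_mul_of_nonneg_right hL₁ (mul_nonneg hθ0 hn0)
    have r3 : ε * (Ψ * θ * n) ≤ 1 / 4 * (Ψ * θ * n) :=
      mul_le_mul_of_nonneg_right hε1 (mul_nonneg hΨθ hn0)
    have r4 : ε * (C * θ * n) ≤ 1 / 4 * (C * θ * n) :=
      mul_le_mul_of_nonneg_right hε1 (mul_nonneg (mul_nonneg hC hθ0) hn0)
    have r5 : 0 ≤ Ψ * θ * n := mul_nonneg hΨθ hn0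
    have r6 : 0 ≤ C * θ * n := mul_nonneg (mul_nonneg hC hθ0) hn0
    linarith only [tri, f1, q2, p2, p2', E2, d2, r1, r2, r3, r4, r5, r6]

end Estimates

/-! ### Stable almost flows are Lipschitz-close to the identity on short horizons -/

section NearIdentity

variable {V : Type*} [NormedAddCommGroup V]

theorem FourPointsControl.norm_le {f : V → V} {fhat : ℝ≥0 → ℝ≥0} {fcheck : ℝ≥0}
    (h : FourPointsControl f fhat fcheck) {x : ℝ≥0} {a b c d : V} (hab : ‖a - b‖ ≤ x)
    (hcd : ‖c - d‖ ≤ x) :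
    ‖f a - f b - f c + f d‖ ≤
      fhat x * max ‖a - c‖ ‖b - d‖ + fcheck * ‖a - b - c + d‖ := by
  have h1 : max ‖a - b‖₊ ‖c - d‖₊ ≤ x := max_le (by exact_mod_cast hab) (by exact_mod_cast hcd)
  have h2 : ‖f a - f b - f c + f d‖₊ ≤
      fhat x * max ‖a - c‖₊ ‖b - d‖₊ + fcheck * ‖a - b - c + d‖₊ := by
    refine (h.bound a b c d).trans ?_
    gcongr
    exact h.monotone h1
  exact_mod_cast h2

/-- A map that is uniformly close to the identity and satisfies a 4-points control is close to the
identity in the Lipschitz seminorm: on a short increment `k`, the increments of `f` along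
`b, b + k, …, b + n k` with `n ‖k‖ ≈ ρ` differ by at most `fhat ρ ‖k‖`, and their sum differs
from `n k` by at most `2 δ`. -/
theorem FourPointsControl.norm_sub_sub_le [NormedSpace ℝ V] {f : V → V} {fhat : ℝ≥0 → ℝ≥0}
    {fcheck : ℝ≥0} (h : FourPointsControl f fhat fcheck) {δ : ℝ} (hδ : ∀ a, ‖f a - a‖ ≤ δ)
    {ρ : ℝ≥0} (hρ : 0 < ρ) (a b : V) :
    ‖(f a - a) - (f b - b)‖ ≤ (4 * δ / ρ + fhat ρ) * ‖a - b‖ := by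
  have hδ0 : 0 ≤ δ := (norm_nonneg _).trans (hδ 0)
  have hρ' : (0 : ℝ) < ρ := hρ
  have hfar : ∀ x y : V, ‖(f x - x) - (f y - y)‖ ≤ 2 * δ := fun x y => by
    have := norm_sub_le (f x - x) (f y - y)
    linarith [hδ x, hδ y]
  obtain ⟨k, rfl⟩ : ∃ k, a = b + k := ⟨a - b, by abel⟩
  rw [add_sub_cancel_left]
  rcases eq_or_ne k 0 with rfl | hk
  · simp
  have hk0 : 0 < ‖k‖ := norm_pos_iff.mpr hk
  have hf0 : (0 : ℝ) ≤ fhat ρ := NNReal.coe_nonneg _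
  rcases le_or_gt (ρ : ℝ) ‖k‖ with hge | hlt
  · refine (hfar _ _).trans ?_
    have h1 : 4 * δ ≤ 4 * δ / ρ * ‖k‖ := by
      rw [div_mul_eq_mul_div, le_div_iff₀ hρ']
      exact mul_le_mul_of_nonneg_left hge (by positivity)
    have h2 : 0 ≤ fhat ρ * ‖k‖ := by positivity
    linarith
  · set n : ℕ := ⌊(ρ : ℝ) / ‖k‖⌋₊ with hn
    have hn1 : (1 : ℝ) ≤ n := by
      exact_mod_cast Nat.le_floor (by rw [Nat.cast_one, le_div_iff₀ hk0]; linarith)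
    have hnle : n * ‖k‖ ≤ ρ := (le_div_iff₀ hk0).mp (Nat.floor_le (by positivity))
    have hnge : ρ ≤ 2 * n * ‖k‖ := by
      have h1 := (div_lt_iff₀ hk0).mp (Nat.lt_floor_add_one ((ρ : ℝ) / ‖k‖))
      rw [← hn] at h1
      have h2 := mul_le_mul_of_nonneg_right hn1 hk0.le
      linarith
    set g : V → V := fun x => f x - x with hg
    have hstep : ∀ i ∈ Finset.range n,
        ‖(g (b + k) - g b) - (g (b + (i + 1) • k) - g (b + i • k))‖ ≤ fhat ρ * ‖k‖ := by
      intro i hi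
      have hik : ‖i • k‖ ≤ ρ := by
        refine (norm_nsmul_le).trans (le_trans ?_ hnle)
        exact mul_le_mul_of_nonneg_right (by exact_mod_cast (Finset.mem_range.mp hi).le) hk0.le
      have h1 := h.norm_le (x := ρ) (a := b + k) (b := b + (i + 1) • k) (c := b)
        (d := b + i • k)
        (by rw [show b + k - (b + (i + 1) • k) = -(i • k) by rw [succ_nsmul]; abel, norm_neg]
            exact hik)
        (by rw [show b - (b + i • k) = -(i • k) by abel, norm_neg]; exact hik)
      rw [show b + k - (b + (i + 1) • k) - b + (b + i • k) = 0 by rw [succ_nsmul]; abel,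
        show b + k - b = k by abel,
        show b + (i + 1) • k - (b + i • k) = k by rw [succ_nsmul]; abel,
        max_self, norm_zero, mul_zero, add_zero] at h1
      refine le_of_eq_of_le (congrArg norm ?_) h1
      simp only [hg, succ_nsmul]
      abel
    have hsum := (norm_sum_le _ _).trans (Finset.sum_le_sum hstep)
    rw [Finset.sum_sub_distrib, Finset.sum_range_sub (fun i => g (b + i • k)) n,
      Finset.sum_const, Finset.sum_const, Finset.card_range, zero_nsmul, add_zero] at hsum
    have h1 : ‖n • (g (b + k) - g b)‖ = n * ‖g (b + k) - g b‖ := by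
      rw [← Nat.cast_smul_eq_nsmul ℝ, norm_smul, Real.norm_natCast]
    have h2 := norm_le_norm_sub_add (n • (g (b + k) - g b)) (g (b + n • k) - g b)
    have h3 := hfar (b + n • k) b
    rw [nsmul_eq_mul] at hsum
    have h4 : n * ‖g (b + k) - g b‖ ≤ n * (fhat ρ * ‖k‖) + 2 * δ := by
      rw [← h1]; linarith
    have h5 : 2 * δ ≤ n * (4 * δ / ρ * ‖k‖) := by
      rw [show (n : ℝ) * (4 * δ / ρ * ‖k‖) = (2 * δ) * (2 * n * ‖k‖) / ρ by ring,
        le_div_iff₀ hρ']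
      exact mul_le_mul_of_nonneg_left hnge (by positivity)
    have h6 : n * ‖g (b + k) - g b‖ ≤ n * ((4 * δ / ρ + fhat ρ) * ‖k‖) := by linarith
    exact le_of_mul_le_mul_left h6 (by linarith)

/-- On short horizons a stable almost flow satisfies the estimates of `StableOn` with an arbitrarily
small `ε` and with constants that do not depend on `ε`. -/
theorem IsStableAlmostFlow.exists_stableOn [NormedSpace ℝ V] {T₀ : ℝ} (hT₀ : 0 < T₀)
    {ω : ℝ → ℝ → ℝ≥0} {ϖ : ℝ≥0 → ℝ≥0} {δ : ℝ → ℝ≥0} {η : ℝ≥0 → ℝ≥0}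
    (hset : IsSetting T₀ ω ϖ δ 1 η) {φ : ℝ → ℝ → V → V} (hφ : IsStableAlmostFlow T₀ ω ϖ δ η φ) :
    ∃ (M C : ℝ≥0) (Φ : ℝ≥0 → ℝ≥0), ∀ ε : ℝ, 0 < ε →
      ∀ᶠ T in 𝓝[>] (0 : ℝ), StableOn T ω ϖ ε M C Φ φ := by
  obtain ⟨M, hM⟩ := hφ.almostFlow.defect
  obtain ⟨C, hC⟩ := hφ.lipschitz_defect
  obtain ⟨φhat, φcheck, h4, hcheck⟩ := hφ.fourPoints
  obtain ⟨Φ, hΦ⟩ := h4.compatible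
  refine ⟨M, C, Φ, fun ε hε => ?_⟩
  have hθ := tendsto_remainder_horizon hT₀ hset.control hset.remainder
  have hδ : Filter.Tendsto (fun T => (δ T : ℝ)) (𝓝[>] 0) (𝓝 0) := by
    simpa using NNReal.tendsto_coe.mpr hset.delta_tendsto
  -- the horizon `S` and the length `ρ` make `φhat S 0 ρ` small
  have hS : ∀ᶠ S in 𝓝[>] (0 : ℝ), (Φ 0 : ℝ) * ϖ (ω 0 S) < ε / 2 ∧ S ∈ Set.Ioc 0 T₀ := by
    refine Filter.Eventually.and ?_ (Ioc_mem_nhdsGT hT₀)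
    have h1 := hθ.const_mul (Φ 0 : ℝ)
    rw [mul_zero] at h1
    exact h1.eventually (gt_mem_nhds (by positivity))
  obtain ⟨S, hS1, hS0, hST⟩ := hS.exists
  have hzero : (φhat S 0 0 : ℝ) < ε / 2 := by
    have h1 := hΦ 0 0 S le_rfl hS0.le hST
    rw [zero_mul] at h1
    exact lt_of_le_of_lt (by exact_mod_cast h1) hS1
  obtain ⟨ρ, hρ1, hρ0⟩ : ∃ ρ : ℝ≥0, (φhat S 0 ρ : ℝ) < ε / 2 ∧ 0 < ρ := by
    have hc : Continuous fun x => (φhat S 0 x : ℝ) :=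
      NNReal.continuous_coe.comp (h4.control 0 S le_rfl hS0.le hST).continuous
    have h1 : ∀ᶠ x in 𝓝[>] (0 : ℝ≥0), (φhat S 0 x : ℝ) < ε / 2 :=
      (hc.tendsto 0).mono_left nhdsWithin_le_nhds |>.eventually (gt_mem_nhds hzero)
    exact (h1.and self_mem_nhdsWithin).exists
  have hρ0' : (0 : ℝ) < ρ := hρ0
  filter_upwards [hδ.eventually (gt_mem_nhds (show 0 < ε by positivity)),
    hδ.eventually (gt_mem_nhds (show 0 < ε * ρ / 8 by positivity)), Ioc_mem_nhdsGT hS0]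
    with T hT1 hT2 hT3
  have hTT : T ≤ T₀ := hT3.2.trans hST
  refine ⟨fun t h0 h1 => hφ.almostFlow.diag t h0 (h1.trans hTT), ?_, ?_, ?_, ?_⟩
  · intro s t h0 hst hT a b
    have h1 := (h4.control s t h0 hst (hT.trans hTT)).norm_sub_sub_le (δ := δ T)
      (fun a => by exact_mod_cast hφ.almostFlow.near_id T hT3.1 hTT s t h0 hst hT a) hρ0 a b
    refine h1.trans (mul_le_mul_of_nonneg_right ?_ (norm_nonneg _))
    have h2 : (φhat t s ρ : ℝ) ≤ φhat S 0 ρ := by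
      exact_mod_cast h4.mono 0 s t S le_rfl h0 hst (hT.trans hT3.2) hST ρ
    have h3 : 4 * (δ T : ℝ) / ρ ≤ ε / 2 := by
      rw [div_le_iff₀ hρ0']; linarith
    linarith
  · intro r s t h0 hrs hst hT a
    exact_mod_cast hM r s t h0 hrs hst (hT.trans hTT) a
  · intro r s t h0 hrs hst hT a b
    have := (hC r s t h0 hrs hst (hT.trans hTT)).norm_sub_le a b
    exact_mod_cast this
  · intro α r s s' t h0 hrs hss hst hT a b c d hab hcd
    have h1 := (h4.control s s' (h0.trans hrs) hss (hst.trans (hT.trans hTT))).norm_le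
      (x := α * ϖ (ω r t)) (by exact_mod_cast hab) (by exact_mod_cast hcd)
    have h2 : (φhat s' s (α * ϖ (ω r t)) : ℝ) ≤ Φ α * ϖ (ω r t) := by
      exact_mod_cast (h4.mono r s s' t h0 hrs hss hst (hT.trans hTT) _).trans
        (hΦ α r t h0 (hrs.trans (hss.trans hst)) (hT.trans hTT))
    have h3 : (φcheck s' s : ℝ) ≤ 1 + ε := by
      have h4 : (φcheck s' s : ℝ) ≤ 1 + δ T := by
        exact_mod_cast hcheck T hT3.1 hTT s s' (h0.trans hrs) hss (hst.trans hT)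
      linarith
    refine h1.trans (add_le_add ?_ ?_)
    · exact mul_le_mul_of_nonneg_right h2 (le_max_of_le_left (norm_nonneg _))
    · exact mul_le_mul_of_nonneg_right h3 (norm_nonneg _)

end NearIdentity

/-! ### The limit of the iterated products -/

section Limit

variable {V : Type*} [NormedAddCommGroup V]

/-- `σ` meets the interior of every subinterval of `[0, T]` of length at least `ρ`. The points `0`
and `T` need not belong to `σ`. -/
def IsFine (T ρ : ℝ) (σ : Finset ℝ) : Prop :=
  ∀ u v : ℝ, 0 ≤ u → u ≤ v → v ≤ T → (∀ w ∈ σ, ¬(u < w ∧ w < v)) → v - u < ρ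

theorem exists_isFine (T : ℝ) {ρ : ℝ} (hρ : 0 < ρ) : ∃ σ : Finset ℝ, IsFine T ρ σ := by
  obtain ⟨N, hN⟩ := exists_nat_gt (T / (ρ / 2))
  -- the step is `ρ / 2`, so that a grid point lies strictly inside an interval of length `ρ`
  have hρ2 : 0 < ρ / 2 := by positivity
  refine ⟨(Finset.range (N + 1)).image fun k : ℕ => (k : ℝ) * (ρ / 2), fun u v h0 huv hT hno => ?_⟩
  by_contra hle
  rw [not_lt] at hle
  have h1 := Nat.floor_le (show 0 ≤ u / (ρ / 2) by positivity)
  have h2 := Nat.lt_floor_add_one (u / (ρ / 2))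
  set k := ⌊u / (ρ / 2)⌋₊
  rw [le_div_iff₀ hρ2] at h1
  rw [div_lt_iff₀ hρ2] at h2
  rw [div_lt_iff₀ hρ2] at hN
  have h3 : ((k + 1 : ℕ) : ℝ) * (ρ / 2) < v := by push_cast; linarith
  refine hno _ (Finset.mem_image_of_mem _ (Finset.mem_range.mpr ?_))
    ⟨by push_cast; exact h2, h3⟩
  have h4 : ((k + 1 : ℕ) : ℝ) < N := lt_of_mul_lt_mul_right (by linarith) hρ2.le
  have h5 : k + 1 < N := by exact_mod_cast h4
  omega

variable {T : ℝ} {ω : ℝ → ℝ → ℝ≥0} {ϖ : ℝ≥0 → ℝ≥0} {L₀ : ℝ≥0} {φ : ℝ → ℝ → V → V}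

/-- Two families that split at the points of a fine set and agree up to `D ϖ(ω)` on its successive
intervals are uniformly close, since `∑ ϖ(ω_{t_i,t_{i+1}})` is a small fraction of `ω_{0,T}`. -/
theorem exists_forall_isFine_norm_sub_le (hω : IsControl T ω) (hϖ : IsRemainder ϖ) (D : ℝ≥0)
    {e : ℝ} (he : 0 < e) : ∃ ρ : ℝ, 0 < ρ ∧ ∀ σ : Finset ℝ, IsFine T ρ σ →
      ∀ X Y : ℝ → ℝ → V → V,
      (∀ s u t : ℝ, 0 ≤ s → s ≤ u → u ≤ t → t ≤ T → u ∈ σ → X t u ∘ X u s = X t s) →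
      (∀ s u t : ℝ, 0 ≤ s → s ≤ u → u ≤ t → t ≤ T → u ∈ σ → Y t u ∘ Y u s = Y t s) →
      (∀ s t : ℝ, 0 ≤ s → s ≤ t → t ≤ T → ∀ a b : V, ‖Y t s a - Y t s b‖ ≤ 2 * ‖a - b‖) →
      (∀ s t : ℝ, 0 ≤ s → s ≤ t → t ≤ T → (∀ w ∈ σ, ¬(s < w ∧ w < t)) →
        ∀ a : V, ‖X t s a - Y t s a‖ ≤ D * ϖ (ω s t)) →
      ∀ s t : ℝ, 0 ≤ s → s ≤ t → t ≤ T → ∀ a : V, ‖X t s a - Y t s a‖ ≤ e := by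
  have hE : 0 < 2 * (D : ℝ) * ω 0 T + 1 := by positivity
  obtain ⟨ρ, hρ, hfine⟩ := exists_forall_remainder_le hω hϖ (div_pos he hE)
  refine ⟨ρ, hρ, fun σ hσ X Y hX hY hLip hadj s t h0 hst hT a => ?_⟩
  have h1 := norm_sub_le_of_adjacent hω σ (c := D * (e / (2 * (D : ℝ) * ω 0 T + 1)))
    one_le_two (by positivity) hX hY hLip
    (fun u v h0 huv hT hno a => by
      rw [mul_assoc]
      exact (hadj u v h0 huv hT hno a).trans (mul_le_mul_of_nonneg_left
        (hfine u v h0 huv hT (hσ u v h0 huv hT hno)) D.coe_nonneg))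
    s t h0 hst hT a
  have h2 : (ω s t : ℝ) ≤ ω 0 T := by
    exact_mod_cast hω.le_of_subinterval le_rfl h0 hst hT le_rfl
  refine h1.trans ((mul_le_mul_of_nonneg_left h2 (by positivity)).trans ?_)
  rw [show 2 * ((D : ℝ) * (e / (2 * D * ω 0 T + 1))) * ω 0 T =
    e * (2 * D * ω 0 T) / (2 * D * ω 0 T + 1) by ring, div_le_iff₀ hE]
  linarith

/-- The iterated products form a Cauchy net along the directed set of finite sets of times, as soon
as they stay close to `φ` and are uniformly Lipschitz. -/
theorem cauchySeq_iteratedProduct (hω : IsControl T ω) (hϖ : IsRemainder ϖ)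
    (hdiag : ∀ t : ℝ, 0 ≤ t → t ≤ T → φ t t = id)
    (hsup : ∀ σ : Finset ℝ, ∀ s t : ℝ, 0 ≤ s → s ≤ t → t ≤ T → ∀ a,
      ‖iteratedProduct φ σ t s a - φ t s a‖ ≤ L₀ * ϖ (ω s t))
    (hLip : ∀ σ : Finset ℝ, ∀ s t : ℝ, 0 ≤ s → s ≤ t → t ≤ T → ∀ a b,
      ‖iteratedProduct φ σ t s a - iteratedProduct φ σ t s b‖ ≤ 2 * ‖a - b‖)
    {s t : ℝ} (h0 : 0 ≤ s) (hst : s ≤ t) (hT : t ≤ T) (a : V) :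
    CauchySeq fun σ : Finset ℝ => iteratedProduct φ σ t s a := by
  rw [Metric.cauchySeq_iff']
  intro e he
  obtain ⟨ρ, hρ, hfine⟩ := exists_forall_isFine_norm_sub_le (V := V) hω hϖ L₀ (half_pos he)
  obtain ⟨σ₀, hσ₀⟩ := exists_isFine T hρ
  refine ⟨σ₀, fun σ hσ => ?_⟩
  rw [dist_eq_norm]
  refine lt_of_le_of_lt (hfine σ₀ hσ₀ (fun t s => iteratedProduct φ σ t s)
    (fun t s => iteratedProduct φ σ₀ t s)
    (fun s u t h0 hsu hut hT hu =>
      iteratedProduct_comp hsu hut (hσ hu) (hdiag u (h0.trans hsu) (hut.trans hT)))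
    (fun s u t h0 hsu hut hT hu =>
      iteratedProduct_comp hsu hut hu (hdiag u (h0.trans hsu) (hut.trans hT)))
    (hLip σ₀) (fun u v h0 huv hT hno a => ?_) s t h0 hst hT a) (half_lt_self he)
  rw [iteratedProduct_eq_of_forall_notMem (σ := σ₀) huv (hdiag u h0 (huv.trans hT))
    (hdiag v (h0.trans huv) hT) hno]
  exact hsup σ u v h0 huv hT a

/-- The limit of the iterated products along the directed set of finite sets of times. Every given
time eventually belongs to these sets, so that the limit is multiplicative. -/
theorem exists_semiflow [CompleteSpace V] (hω : IsControl T ω) (hϖ : IsRemainder ϖ)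
    (hdiag : ∀ t : ℝ, 0 ≤ t → t ≤ T → φ t t = id) {L₁ : ℝ≥0}
    (hsup : ∀ σ : Finset ℝ, ∀ s t : ℝ, 0 ≤ s → s ≤ t → t ≤ T → ∀ a,
      ‖iteratedProduct φ σ t s a - φ t s a‖ ≤ L₀ * ϖ (ω s t))
    (hLip : ∀ σ : Finset ℝ, ∀ s t : ℝ, 0 ≤ s → s ≤ t → t ≤ T → ∀ a b,
      ‖iteratedProduct φ σ t s a - iteratedProduct φ σ t s b‖ ≤ 2 * ‖a - b‖)
    (hsub : ∀ σ : Finset ℝ, ∀ s t : ℝ, 0 ≤ s → s ≤ t → t ≤ T → ∀ a b,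
      ‖(iteratedProduct φ σ t s a - φ t s a) - (iteratedProduct φ σ t s b - φ t s b)‖ ≤
        L₁ * ϖ (ω s t) * ‖a - b‖) :
    ∃ Ψ : ℝ → ℝ → V → V, (∀ t : ℝ, 0 ≤ t → t ≤ T → Ψ t t = id) ∧
      (∀ r s t : ℝ, 0 ≤ r → r ≤ s → s ≤ t → t ≤ T → Ψ t s ∘ Ψ s r = Ψ t r) ∧
      (∀ s t : ℝ, 0 ≤ s → s ≤ t → t ≤ T → ∀ a, ‖Ψ t s a - φ t s a‖ ≤ L₀ * ϖ (ω s t)) ∧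
      ∀ s t : ℝ, 0 ≤ s → s ≤ t → t ≤ T → ∀ a b,
        ‖(Ψ t s a - φ t s a) - (Ψ t s b - φ t s b)‖ ≤ L₁ * ϖ (ω s t) * ‖a - b‖ := by
  have hlim : ∀ t s : ℝ, ∀ a : V, ∃ y : V, 0 ≤ s → s ≤ t → t ≤ T →
      Filter.Tendsto (fun σ : Finset ℝ => iteratedProduct φ σ t s a) Filter.atTop (𝓝 y) := by
    intro t s a
    by_cases h : 0 ≤ s ∧ s ≤ t ∧ t ≤ T
    · obtain ⟨y, hy⟩ := cauchySeq_tendsto_of_complete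
        (cauchySeq_iteratedProduct hω hϖ hdiag hsup hLip h.1 h.2.1 h.2.2 a)
      exact ⟨y, fun _ _ _ => hy⟩
    · exact ⟨0, fun h1 h2 h3 => absurd ⟨h1, h2, h3⟩ h⟩
  choose Ψ hΨ using hlim
  refine ⟨Ψ, fun t h0 hT => ?_, fun r s t h0 hrs hst hT => ?_, fun s t h0 hst hT a => ?_,
    fun s t h0 hst hT a b => ?_⟩
  · funext a
    refine tendsto_nhds_unique (hΨ t t a h0 le_rfl hT) ?_
    refine tendsto_const_nhds.congr fun σ => ?_
    rw [iteratedProduct_eq_of_forall_notMem le_rfl (hdiag t h0 hT) (hdiag t h0 hT)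
      fun w _ h => lt_irrefl _ (h.1.trans h.2), hdiag t h0 hT]
  · funext a
    have hs0 := h0.trans hrs
    have h1 := hΨ s r a h0 hrs (hst.trans hT)
    have h2 := hΨ t s (Ψ s r a) hs0 hst hT
    refine tendsto_nhds_unique h2 ?_
    have h3 : Filter.Tendsto (fun σ : Finset ℝ => iteratedProduct φ σ t s (Ψ s r a) -
        iteratedProduct φ σ t s (iteratedProduct φ σ s r a)) Filter.atTop (𝓝 0) := by
      refine squeeze_zero_norm (fun σ => hLip σ s t hs0 hst hT _ _) ?_
      have := ((tendsto_const_nhds (x := Ψ s r a)).sub h1).norm.const_mul 2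
      simpa using this
    have h4 := h3.add (hΨ t r a h0 (hrs.trans hst) hT)
    rw [zero_add] at h4
    refine h4.congr' ?_
    filter_upwards [Filter.eventually_ge_atTop ({s} : Finset ℝ)] with σ hσ
    rw [← iteratedProduct_comp hrs hst (hσ (Finset.mem_singleton_self s))
      (hdiag s hs0 (hst.trans hT))]
    simp
  · exact le_of_tendsto ((hΨ t s a h0 hst hT).sub_const _).norm
      (Filter.Eventually.of_forall fun σ => hsup σ s t h0 hst hT a)
  · exact le_of_tendsto (((hΨ t s a h0 hst hT).sub_const _).sub
      ((hΨ t s b h0 hst hT).sub_const _)).norm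
      (Filter.Eventually.of_forall fun σ => hsub σ s t h0 hst hT a b)

end Limit

/-! ### Partitions of small mesh -/

section Partitions

/-- The times `u` and `v` in `IsFine` need not belong to `π`: the gap between them lies in the one
between the last point of `π` before `u` and the first one after `v`. -/
theorem IsPartition.isFine {T ρ : ℝ} {π : Finset ℝ} (hπ : IsPartition T π) (hρ : 0 < ρ)
    (hmesh : mesh π < ρ) : IsFine T ρ π := by
  intro u v h0 huv hT hno
  rcases eq_or_lt_of_le huv with rfl | hlt
  · simpa using hρ
  have hA : (π.filter (fun w => w ≤ u)).Nonempty := ⟨0, Finset.mem_filter.mpr ⟨hπ.1, h0⟩⟩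
  have hB : (π.filter (fun w => v ≤ w)).Nonempty := ⟨T, Finset.mem_filter.mpr ⟨hπ.2.1, hT⟩⟩
  have hu := Finset.mem_filter.mp (Finset.max'_mem _ hA)
  have hv := Finset.mem_filter.mp (Finset.min'_mem _ hB)
  have hsucc : Successive π (Finset.max' _ hA) (Finset.min' _ hB) := by
    refine ⟨hu.1, hv.1, hu.2.trans_lt (hlt.trans_le hv.2), fun w hw => ?_⟩
    rcases le_or_gt w u with h | h
    · exact Or.inl (Finset.le_max' _ _ (Finset.mem_filter.mpr ⟨hw, h⟩))
    · exact Or.inr (Finset.min'_le _ _ (Finset.mem_filter.mpr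
        ⟨hw, not_lt.mp fun h' => hno w hw ⟨h, h'⟩⟩))
  have hbdd : BddAbove {d : ℝ | ∃ u v : ℝ, Successive π u v ∧ d = v - u} := by
    refine ⟨T, ?_⟩
    rintro d ⟨x, y, hxy, rfl⟩
    have h1 := (hπ.2.2 x hxy.1).1
    have h2 := (hπ.2.2 y hxy.2.1).2
    linarith
  have h1 := le_csSup hbdd ⟨_, _, hsucc, rfl⟩
  change _ ≤ mesh π at h1
  linarith [hu.2, hv.2]

end Partitions

/-! ### Inversion and the flow -/

section Flow

variable {V : Type*} [NormedAddCommGroup V]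

theorem norm_sub_le_of_near_id {f : V → V} (hf : ∀ a b, ‖(f a - a) - (f b - b)‖ ≤ 1 / 2 * ‖a - b‖)
    (a b : V) : ‖f a - f b‖ ≤ 2 * ‖a - b‖ ∧ ‖a - b‖ ≤ 2 * ‖f a - f b‖ := by
  have h1 := hf a b
  have h2 := norm_add_le ((f a - a) - (f b - b)) (a - b)
  have h3 := norm_sub_le (f a - f b) ((f a - a) - (f b - b))
  rw [show (f a - a) - (f b - b) + (a - b) = f a - f b by abel] at h2
  rw [show f a - f b - ((f a - a) - (f b - b)) = a - b by abel] at h3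
  have h4 := norm_nonneg (a - b)
  constructor <;> linarith

/-- A perturbation of the identity by a contraction is bijective. -/
theorem bijective_of_near_id [NormedSpace ℝ V] [CompleteSpace V] {f : V → V}
    (hf : ∀ a b, ‖(f a - a) - (f b - b)‖ ≤ 1 / 2 * ‖a - b‖) : Function.Bijective f := by
  refine ⟨fun a b hab => ?_, ?_⟩
  · have h1 := (norm_sub_le_of_near_id hf a b).2
    rw [hab, sub_self, norm_zero, mul_zero] at h1
    exact sub_eq_zero.mp (norm_le_zero_iff.mp h1)
  · have happ : ApproximatesLinearOn f
        ((ContinuousLinearEquiv.refl ℝ V : V ≃L[ℝ] V) : V →L[ℝ] V) Set.univ (1 / 2) := by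
      intro a _ b _
      have h1 := hf a b
      rw [show (f a - a) - (f b - b) = f a - f b - (a - b) by abel] at h1
      simpa using h1
    refine happ.surjective ?_
    rcases subsingleton_or_nontrivial V with hV | hV
    · exact Or.inl hV
    · right
      have : ‖(((ContinuousLinearEquiv.refl ℝ V : V ≃L[ℝ] V).symm : V ≃L[ℝ] V) : V →L[ℝ] V)‖₊
          = 1 := by
        have h1 : (((ContinuousLinearEquiv.refl ℝ V : V ≃L[ℝ] V).symm : V ≃L[ℝ] V) : V →L[ℝ] V) =
          ContinuousLinearMap.id ℝ V := rfl
        rw [h1]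
        exact ContinuousLinearMap.nnnorm_id
      rw [this, inv_one]
      exact NNReal.coe_lt_coe.mp (by norm_num)

open Classical in
/-- The extension of a family of bijections `Ψ t s`, `s ≤ t`, to all pairs of times by inverse
maps. -/
noncomputable def extendByInverse (Ψ : ℝ → ℝ → V → V) (t s : ℝ) : V → V :=
  if s ≤ t then Ψ t s else Function.invFun (Ψ s t)

theorem extendByInverse_of_le {Ψ : ℝ → ℝ → V → V} {s t : ℝ} (h : s ≤ t) :
    extendByInverse Ψ t s = Ψ t s := if_pos h

theorem extendByInverse_leftInverse {Ψ : ℝ → ℝ → V → V} {s t : ℝ} (h : s ≤ t)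
    (hb : Function.Bijective (Ψ t s)) (hd : Ψ t t = id) :
    Function.LeftInverse (extendByInverse Ψ s t) (Ψ t s) := by
  rcases eq_or_lt_of_le h with rfl | hlt
  · rw [extendByInverse_of_le le_rfl, hd]
    exact fun _ => rfl
  · rw [extendByInverse, if_neg (not_le.mpr hlt)]
    exact Function.leftInverse_invFun hb.1

theorem isLipschitzFlow_extendByInverse {T : ℝ} {Ψ : ℝ → ℝ → V → V}
    (hdiag : ∀ t : ℝ, 0 ≤ t → t ≤ T → Ψ t t = id)
    (hcomp : ∀ r s t : ℝ, 0 ≤ r → r ≤ s → s ≤ t → t ≤ T → Ψ t s ∘ Ψ s r = Ψ t r)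
    (hbij : ∀ s t : ℝ, 0 ≤ s → s ≤ t → t ≤ T → Function.Bijective (Ψ t s)) {K : ℝ≥0}
    (hLip : ∀ s t : ℝ, 0 ≤ s → s ≤ t → t ≤ T → ∀ a b,
      ‖Ψ t s a - Ψ t s b‖ ≤ K * ‖a - b‖ ∧ ‖a - b‖ ≤ K * ‖Ψ t s a - Ψ t s b‖) :
    IsLipschitzFlow T (extendByInverse Ψ) := by
  have hL : ∀ s t : ℝ, 0 ≤ s → s ≤ t → t ≤ T →
      Function.LeftInverse (extendByInverse Ψ s t) (Ψ t s) := fun s t h0 hst hT =>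
    extendByInverse_leftInverse hst (hbij s t h0 hst hT) (hdiag t (h0.trans hst) hT)
  have hR : ∀ s t : ℝ, 0 ≤ s → s ≤ t → t ≤ T →
      Function.RightInverse (extendByInverse Ψ s t) (Ψ t s) := fun s t h0 hst hT =>
    (hL s t h0 hst hT).rightInverse_of_surjective (hbij s t h0 hst hT).2
  refine ⟨⟨fun t h0 hT => ?_, fun r s t h => ?_, fun s t h0 hst hT => ?_⟩, K, ?_⟩
  · rw [extendByInverse_of_le le_rfl, hdiag t h0 hT]
  · rcases h with ⟨h0, hrs, hst, hT⟩ | ⟨h0, hts, hsr, hT⟩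
    · rw [extendByInverse_of_le hst, extendByInverse_of_le hrs,
        extendByInverse_of_le (hrs.trans hst), hcomp r s t h0 hrs hst hT]
    · funext y
      obtain ⟨x, rfl⟩ := (hbij t r h0 (hts.trans hsr) hT).2 y
      rw [hL t r h0 (hts.trans hsr) hT x, ← hcomp t s r h0 hts hsr hT, Function.comp_apply,
        Function.comp_apply, hL s r (h0.trans hts) hsr hT, hL t s h0 hts (hsr.trans hT)]
  · rw [extendByInverse_of_le hst]
    exact ⟨hL s t h0 hst hT, hR s t h0 hst hT⟩
  · intro s t hs0 hsT ht0 htT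
    refine LipschitzWith.of_dist_le_mul fun a b => ?_
    rw [dist_eq_norm, dist_eq_norm]
    rcases le_total s t with h | h
    · rw [extendByInverse_of_le h]
      exact (hLip s t hs0 h htT a b).1
    · have h1 := (hLip t s ht0 h hsT (extendByInverse Ψ t s a) (extendByInverse Ψ t s b)).2
      rwa [hR t s ht0 h hsT a, hR t s ht0 h hsT b] at h1

/-- Two flows that agree forward in time agree. -/
theorem IsFlow.eq_of_forall_le {W : Type*} {T : ℝ} {χ ψ : ℝ → ℝ → W → W} (hχ : IsFlow T χ)
    (hψ : IsFlow T ψ) (h : ∀ s t : ℝ, 0 ≤ s → s ≤ t → t ≤ T → χ t s = ψ t s) {s t : ℝ}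
    (hs0 : 0 ≤ s) (hsT : s ≤ T) (ht0 : 0 ≤ t) (htT : t ≤ T) : χ t s = ψ t s := by
  rcases le_total s t with hst | hst
  · exact h s t hs0 hst htT
  · funext y
    have h1 := (hψ.inverse t s ht0 hst hsT).2 y
    have h2 := (hχ.inverse t s ht0 hst hsT).1 (ψ t s y)
    rwa [h t s ht0 hst hsT, h1] at h2

end Flow

end Sewing

theorem mainTheorem2 {V : Type*} [NormedAddCommGroup V] [NormedSpace ℝ V] [CompleteSpace V]
    (T₀ : ℝ) (hT₀ : 0 < T₀) (ω : ℝ → ℝ → ℝ≥0) (ϖ : ℝ≥0 → ℝ≥0) (δ : ℝ → ℝ≥0) (η : ℝ≥0 → ℝ≥0)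
    (hset : Sewing.IsSetting T₀ ω ϖ δ 1 η)
    (φ : ℝ → ℝ → V → V) (hφ : Sewing.IsStableAlmostFlow T₀ ω ϖ δ η φ) :
    ∃ T₁ : ℝ, 0 < T₁ ∧ T₁ ≤ T₀ ∧ ∀ T : ℝ, 0 < T → T ≤ T₁ →
      ∃ ψ : ℝ → ℝ → V → V,
        Sewing.IsLipschitzFlow T ψ ∧
        ψ ∈ Sewing.galaxy T ω ϖ φ ∧
        (∀ χ : ℝ → ℝ → V → V, Sewing.IsFlow T χ → χ ∈ Sewing.galaxy T ω ϖ φ →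
          ∀ s t : ℝ, 0 ≤ s → s ≤ T → 0 ≤ t → t ≤ T → χ t s = ψ t s) ∧
        Sewing.IteratedProductsConverge T φ ψ ∧
        ∃ L : ℝ≥0, ∀ s t : ℝ, 0 ≤ s → s ≤ t → t ≤ T →
          LipschitzWith (L * ϖ (ω s t)) (fun a : V => ψ t s a - φ t s a) := by
  open Sewing in
  have hϖ := hset.remainder
  obtain ⟨κ, -, hκ1, hκ⟩ := hϖ.contraction
  have hκ1' : (κ : ℝ) < 1 := hκ1
  have hκ0 : (0 : ℝ) ≤ κ := κ.coe_nonneg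
  obtain ⟨M, C, Φ, hstable⟩ := hφ.exists_stableOn hT₀ hset
  -- `ε` is such that `κ' = (1 + κ) / 2 < 1` absorbs the Lipschitz constants
  set ε : ℝ := (1 - κ) / 8 with hε
  have hε0 : 0 < ε := by rw [hε]; linarith
  have hε1 : ε ≤ 1 / 4 := by rw [hε]; linarith
  set κ' : ℝ := (1 + κ) / 2 with hκ'def
  have hκ'1 : 0 < 1 - κ' := by rw [hκ'def]; linarith
  have hκ' : (1 + ε) * (1 + 2 * ε) * κ ≤ κ' := by
    have h1 : (1 + ε) * (1 + 2 * ε) ≤ 1 + 4 * ε := by nlinarith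
    have h2 := mul_le_mul_of_nonneg_right h1 hκ0
    have h3 : ε * κ ≤ ε * 1 := mul_le_mul_of_nonneg_left hκ1'.le hε0.le
    rw [hκ'def]
    linarith
  have hsolve : ∀ x : ℝ, ∃ L : ℝ≥0, x ≤ (1 - κ') * L := fun x => by
    refine ⟨(x / (1 - κ')).toNNReal, ?_⟩
    have h1 := mul_le_mul_of_nonneg_left (Real.le_coe_toNNReal (x / (1 - κ'))) hκ'1.le
    rwa [mul_div_cancel₀ _ hκ'1.ne'] at h1
  -- `L₀` and `L₁` depend on `ε` but not on the horizon, which can thus be chosen after them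
  obtain ⟨L₀, hL₀⟩ := hsolve (3 * M)
  obtain ⟨L₁, hL₁⟩ := hsolve (5 * Φ (2 * L₀ + M) + 3 * C)
  have hsmall : ∀ᶠ T in 𝓝[>] (0 : ℝ), (L₁ : ℝ) * ϖ (ω 0 T) < ε := by
    have h1 := (tendsto_remainder_horizon hT₀ hset.control hϖ).const_mul (L₁ : ℝ)
    rw [mul_zero] at h1
    exact h1.eventually (gt_mem_nhds hε0)
  obtain ⟨T₁, hφ₁, hLε, hT₁0, hT₁⟩ :=
    ((hstable ε hε0).and (hsmall.and (Ioc_mem_nhdsGT hT₀))).exists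
  refine ⟨T₁, hT₁0, hT₁, fun T hT0 hT => ?_⟩
  have hω₁ := hset.control.mono hT₁
  have hω := hω₁.mono hT
  -- a map that is Lipschitz-close to `φ t s` is Lipschitz-close to the identity
  have hnear : ∀ F : V → V, ∀ s t : ℝ, 0 ≤ s → s ≤ t → t ≤ T₁ →
      (∀ a b, ‖(F a - φ t s a) - (F b - φ t s b)‖ ≤ L₁ * ϖ (ω s t) * ‖a - b‖) →
      ∀ a b, ‖(F a - a) - (F b - b)‖ ≤ 1 / 2 * ‖a - b‖ := by
    intro F s t h0 hst ht hF a b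
    have h1 := hφ₁.near_id s t h0 hst ht a b
    have h2 := norm_add_le ((F a - φ t s a) - (F b - φ t s b)) ((φ t s a - a) - (φ t s b - b))
    rw [show (F a - φ t s a) - (F b - φ t s b) + ((φ t s a - a) - (φ t s b - b)) =
      (F a - a) - (F b - b) by abel] at h2
    have h3 := mul_le_mul_of_nonneg_left
      (remainder_le_of_subinterval hω₁ hϖ le_rfl h0 hst ht le_rfl) L₁.coe_nonneg
    have h4 : (L₁ : ℝ) * ϖ (ω s t) + ε ≤ 1 / 2 := by linarith
    have h5 := mul_le_mul_of_nonneg_right h4 (norm_nonneg (a - b))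
    linarith [hF a b]
  have hsup := fun σ s t h0 hst ht => hφ₁.norm_iteratedProduct_sub_le hω₁ hϖ hκ hε0.le hε1 hκ'
    hL₀ σ (s := s) (t := t) h0 hst ht
  have hsub := fun σ s t h0 hst ht => hφ₁.norm_iteratedProduct_sub_sub_le hω₁ hϖ hκ hε0.le hε1
    hκ' hL₀ hL₁ hLε.le σ (s := s) (t := t) h0 hst ht
  obtain ⟨Ψ, hΨdiag, hΨcomp, hΨsup, hΨsub⟩ := exists_semiflow hω₁ hϖ hφ₁.diag hsup
    (fun σ s t h0 hst ht a b => (norm_sub_le_of_near_id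
      (hnear _ s t h0 hst ht (hsub σ s t h0 hst ht)) a b).1) hsub
  have hΨid := fun s t h0 hst ht => hnear (Ψ t s) s t h0 hst ht (hΨsub s t h0 hst ht)
  have hΨLip : ∀ s t : ℝ, 0 ≤ s → s ≤ t → t ≤ T → ∀ a b,
      ‖Ψ t s a - Ψ t s b‖ ≤ 2 * ‖a - b‖ := fun s t h0 hst ht a b =>
    (norm_sub_le_of_near_id (hΨid s t h0 hst (ht.trans hT)) a b).1
  have hflow : IsLipschitzFlow T (extendByInverse Ψ) :=
    isLipschitzFlow_extendByInverse (K := 2)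
      (fun t h0 ht => hΨdiag t h0 (ht.trans hT))
      (fun r s t h0 hrs hst ht => hΨcomp r s t h0 hrs hst (ht.trans hT))
      (fun s t h0 hst ht => bijective_of_near_id (hΨid s t h0 hst (ht.trans hT)))
      (fun s t h0 hst ht => norm_sub_le_of_near_id (hΨid s t h0 hst (ht.trans hT)))
  refine ⟨extendByInverse Ψ, hflow, ⟨fun s t h0 hst ht => ?_, L₀, fun s t h0 hst ht a => ?_⟩,
    fun χ hχ hχφ s t hs0 hsT ht0 htT => ?_, fun e he => ?_, L₁, fun s t h0 hst ht => ?_⟩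
  · obtain ⟨K, hK⟩ := hflow.2
    exact (hK s t h0 (hst.trans ht) (h0.trans hst) ht).continuous
  · rw [extendByInverse_of_le hst]
    have h1 := hΨsup s t h0 hst (ht.trans hT) a
    rw [norm_sub_rev] at h1
    exact_mod_cast h1
  · refine hχ.eq_of_forall_le hflow.1 (fun s t h0 hst ht => ?_) hs0 hsT ht0 htT
    rw [extendByInverse_of_le hst]
    obtain ⟨-, C', hC'⟩ := hχφ
    funext a
    refine sub_eq_zero.mp (norm_le_zero_iff.mp (le_of_forall_pos_le_add fun e he => ?_))
    obtain ⟨ρ, hρ, hfine⟩ := exists_forall_isFine_norm_sub_le (V := V) hω hϖ (C' + L₀) he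
    obtain ⟨σ, hσ⟩ := exists_isFine T hρ
    rw [zero_add]
    refine hfine σ hσ χ Ψ (fun s u t h0 hsu hut ht _ => hχ.comp s u t (Or.inl ⟨h0, hsu, hut, ht⟩))
      (fun s u t h0 hsu hut ht _ => hΨcomp s u t h0 hsu hut (ht.trans hT)) hΨLip
      (fun s t h0 hst ht _ a => ?_) s t h0 hst ht a
    have h1 : ‖φ t s a - χ t s a‖ ≤ C' * ϖ (ω s t) := by exact_mod_cast hC' s t h0 hst ht a
    have h2 := hΨsup s t h0 hst (ht.trans hT) a
    have h3 := norm_sub_le_norm_sub_add_norm_sub (χ t s a) (φ t s a) (Ψ t s a)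
    rw [norm_sub_rev] at h1 h2
    push_cast
    linarith
  · obtain ⟨ρ, hρ, hfine⟩ := exists_forall_isFine_norm_sub_le (V := V) hω hϖ L₀ he
    refine ⟨ρ, hρ, fun π hπ hmesh s t h0 hst ht a => ?_⟩
    rw [extendByInverse_of_le hst]
    refine hfine π (hπ.isFine hρ hmesh) (fun t s => iteratedProduct φ π t s) Ψ
      (fun s u t h0 hsu hut ht hu => iteratedProduct_comp hsu hut hu
        (hφ₁.diag u (h0.trans hsu) (hut.trans (ht.trans hT))))
      (fun s u t h0 hsu hut ht _ => hΨcomp s u t h0 hsu hut (ht.trans hT)) hΨLip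
      (fun s t h0 hst ht hno a => ?_) s t h0 hst ht a
    rw [iteratedProduct_eq_of_forall_notMem hst (hφ₁.diag s h0 (hst.trans (ht.trans hT)))
      (hφ₁.diag t (h0.trans hst) (ht.trans hT)) hno, norm_sub_rev]
    exact hΨsup s t h0 hst (ht.trans hT) a
  · rw [extendByInverse_of_le hst]
    refine LipschitzWith.of_dist_le_mul fun a b => ?_
    rw [dist_eq_norm, dist_eq_norm]
    exact_mod_cast hΨsub s t h0 hst (ht.trans hT) a b
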